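/- Let $L\ge 1$ and consider the $L\times L$ square lattice, with $L^2$ plaquettes, $(L+1)^2$ vertices and $n=2L(L+1)$ edges, with one qubit on each edge. Let $\mathcal Z\subseteq\{0,1\}^{n}$ be the set of $1$-cycles, i.e. of edge configurations $x$ having, at every vertex, an even number of incident edges $e$ with $x_e=1$. The planar code state is $$|G_L\rangle=\frac1{\sqrt{|\mathcal Z|}}\sum_{x\in\mathcal Z}|x\rangle .$$ A subcubic tree $T$ for a set $Q$ of qubits is a finite tree all of whose vertices have degree $1$ or $3$, with a bijection between $Q$ and its leaves (vertices of degree $1$). Deleting an edge $e$ of $T$ leaves two components and so induces a bipartition $(A_T^e,B_T^e)$ of $Q$. Let $E_{A,B}(|\psi\rangle)$ be the entanglement entropy of $|\psi\rangle$ in bits (the von Neumann entropy, with base-$2$ logarithm, of the reduced state on $A$). The entanglement width of $|\psi\rangle$ is $E_{\mathrm{wd}}(|\psi\rangle)=\min_T\max_e E_{A_T^e,B_T^e}(|\psi\rangle)$, the minimum being over all subcubic trees for $Q$ and the maximum over the edges of the tree. Then: 1. $E_{\mathrm{wd}}(|G_L\rangle)\ge L$. 2. Every subcubic tree $T$ for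 the $n$ qubits has an edge $e$ with $\frac13 n\le |A_T^e|,|B_T^e|\le\frac23 n$. 3. Tree-tensor-network descriptions of $|G_L\rangle$ are exponentially large in $L$: let $T$ be any subcubic tree for the $n$ qubits and suppose that $|G_L\rangle$ is the contraction of a tensor network on $T$, with an index of some finite dimension $D_e$ on each edge $e$ of $T$, a tensor with one qubit index and one edge index at each leaf, and a tensor with three edge indices at each inner vertex. Then $D_e\ge 2^L$ for some edge $e$, and the tensors have at least $2^L$ entries in total. -/

import Mathlib

open scoped Classical in
/-- For a finite graph `G` with one qubit on each edge: the amplitude vector, in the computational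
basis indexed by 1-chains `x : edges → {0,1}`, of the planar code state
`|G⟩ = |Z|^(-1/2) ∑_{x ∈ Z} |x⟩`. Here `Z` is the set of 1-cycles, that is, of the 1-chains having
an even number of edges `e` with `x_e = 1` at every vertex. -/
noncomputable def planarCodeState {V : Type*} [Fintype V] (G : SimpleGraph V) :
    (G.edgeSet → ZMod 2) → ℂ :=
  let Z : Set (G.edgeSet → ZMod 2) :=
    {x | ∀ s : V, ∑ e ∈ Finset.univ.filter (fun e : G.edgeSet => s ∈ (e : Sym2 V)), x e = 0}
  fun x => if x ∈ Z then ((1 / Real.sqrt (Z.ncard : ℝ) : ℝ) : ℂ) else 0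

/-- The `L × L` square lattice: `L ^ 2` plaquettes, `(L + 1) ^ 2` vertices and
`2 * L * (L + 1)` edges. -/
abbrev squareLattice (L : ℕ) : SimpleGraph (Fin (L + 1) × Fin (L + 1)) :=
  SimpleGraph.boxProd (SimpleGraph.pathGraph (L + 1)) (SimpleGraph.pathGraph (L + 1))

/-- The qubits of the `L × L` lattice live on its edges. -/
abbrev LatticeQubit (L : ℕ) : Type := (squareLattice L).edgeSet

section Entropy

variable {Q : Type*}

open scoped Classical in
/-- The amplitudes of a state `ψ` of the qubits `Q`, as a matrix with rows indexed by the basis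
states of the qubits in `A` and columns by those of the qubits outside `A`. -/
noncomputable def amplitudeMatrix (ψ : (Q → ZMod 2) → ℂ) (A : Set Q) :
    Matrix (A → ZMod 2) ({q // q ∉ A} → ZMod 2) ℂ :=
  fun y z => ψ (fun q => if h : q ∈ A then y ⟨q, h⟩ else z ⟨q, h⟩)

variable [Fintype Q]

open scoped Classical in
/-- The reduced density matrix `Tr_{Q ∖ A} |ψ⟩⟨ψ|` of the qubits in `A`: its entry at `(y, y')` is
`∑ z, ψ(y, z) * conj ψ(y', z)`. -/
noncomputable def reducedDensity (ψ : (Q → ZMod 2) → ℂ) (A : Set Q) :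
    Matrix (A → ZMod 2) (A → ZMod 2) ℂ :=
  amplitudeMatrix ψ A * (amplitudeMatrix ψ A).conjTranspose

open scoped Classical in
theorem reducedDensity_isHermitian (ψ : (Q → ZMod 2) → ℂ) (A : Set Q) :
    (reducedDensity ψ A).IsHermitian :=
  Matrix.isHermitian_mul_conjTranspose_self _

open scoped Classical in
/-- The entanglement entropy (in bits) of the pure state `ψ` with respect to the bipartition
`(A, Aᶜ)`: the von Neumann entropy `-∑ p log₂ p` over the spectrum of the reduced density matrix,
with `0 log₂ 0 = 0`. -/
noncomputable def entanglementEntropy (ψ : (Q → ZMod 2) → ℂ) (A : Set Q) : ℝ :=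
  -∑ i, (reducedDensity_isHermitian ψ A).eigenvalues i *
    Real.logb 2 ((reducedDensity_isHermitian ψ A).eigenvalues i)

/-- The bipartition `(A, Aᶜ)` is balanced: both parts have between `1/3` and `2/3` of the
qubits. -/
def IsBalanced (A : Set Q) : Prop :=
  (1 / 3 * (Fintype.card Q : ℝ) ≤ (A.ncard : ℝ) ∧
    (A.ncard : ℝ) ≤ 2 / 3 * (Fintype.card Q : ℝ)) ∧
  (1 / 3 * (Fintype.card Q : ℝ) ≤ (Aᶜ.ncard : ℝ) ∧
    (Aᶜ.ncard : ℝ) ≤ 2 / 3 * (Fintype.card Q : ℝ))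

end Entropy

/-- A subcubic tree for the qubits `Q`: a finite tree, each vertex having 1 or 3 incident edges,
together with a bijection from `Q` to its leaves (the vertices with one incident edge). -/
structure SubcubicTree (Q : Type*) where
  V : Type
  [fintypeV : Fintype V]
  graph : SimpleGraph V
  isTree : graph.IsTree
  degree_eq : ∀ v, (graph.neighborSet v).ncard = 1 ∨ (graph.neighborSet v).ncard = 3
  leaf : Q ≃ {v : V // (graph.neighborSet v).ncard = 1}

attribute [instance] SubcubicTree.fintypeV

namespace SubcubicTree

variable {Q : Type*}

/-- For an edge `e = uv` of the tree, given with an orientation `d = (u, v)`: the set of the qubits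
whose leaves lie in the connected component of `u` in `T ∖ e`. The bipartition of `Q` induced by `e`
is `(T.side d, (T.side d)ᶜ)`; reversing `d` swaps the two parts. -/
def side (T : SubcubicTree Q) (d : T.graph.Dart) : Set Q :=
  {q | (T.graph.deleteEdges {d.edge}).Reachable d.fst (T.leaf q : T.V)}

/-- The largest entanglement entropy over the bipartitions induced by the edges of `T`. -/
noncomputable def maxEntropy [Fintype Q] (T : SubcubicTree Q) (ψ : (Q → ZMod 2) → ℂ) : ℝ :=
  ⨆ d : T.graph.Dart, entanglementEntropy ψ (T.side d)

/-- The edges of `T` at the vertex `v`. -/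
abbrev Incident (T : SubcubicTree Q) (v : T.V) : Type :=
  {e : T.graph.edgeSet // v ∈ (e : Sym2 T.V)}

end SubcubicTree

/-- The entanglement width of a state: the minimum, over all subcubic trees whose leaves are the
qubits, of the maximum over the tree edges of the entanglement entropy of the induced
bipartition. -/
noncomputable def entanglementWidth {Q : Type*} [Fintype Q] (ψ : (Q → ZMod 2) → ℂ) : ℝ :=
  ⨅ T : SubcubicTree Q, T.maxEntropy ψ

/-- A tree tensor network on the subcubic tree `T`: each tree edge `e` carries an index of
dimension `bond e`; each leaf carries a tensor with a qubit index and one index for its edge, and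
each inner vertex a tensor with one index for each of its three edges. -/
structure TreeTensorNetwork {Q : Type*} (T : SubcubicTree Q) where
  bond : T.graph.edgeSet → ℕ
  leafTensor : (q : Q) → ((e : T.Incident (T.leaf q)) → Fin (bond e.1)) → ZMod 2 → ℂ
  innerTensor : (v : {v : T.V // (T.graph.neighborSet v).ncard = 3}) →
    ((e : T.Incident v.1) → Fin (bond e.1)) → ℂ

namespace TreeTensorNetwork

variable {Q : Type*} [Fintype Q] {T : SubcubicTree Q}

open scoped Classical in
/-- The state described by a tree tensor network: the full contraction over all tree edges. -/
noncomputable def state (N : TreeTensorNetwork T) : (Q → ZMod 2) → ℂ :=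
  fun x => ∑ b : (e : T.graph.edgeSet) → Fin (N.bond e),
    (∏ q, N.leafTensor q (fun e => b e.1) (x q)) * ∏ v, N.innerTensor v (fun e => b e.1)

open scoped Classical in
/-- The number of complex numbers by which a tree tensor network is specified: the total number of
entries of its tensors. -/
noncomputable def numEntries (N : TreeTensorNetwork T) : ℕ :=
  (∑ q, Fintype.card (((e : T.Incident (T.leaf q)) → Fin (N.bond e.1)) × ZMod 2)) +
    ∑ v : {v : T.V // (T.graph.neighborSet v).ncard = 3},
      Fintype.card ((e : T.Incident v.1) → Fin (N.bond e.1))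

end TreeTensorNetwork

open scoped Classical in
noncomputable instance LatticeQubit.instFintype (L : ℕ) : Fintype (LatticeQubit L) := inferInstance

/-! The state is the uniform superposition of a linear code, the cycle space `Z`. Its reduced
density matrices have flat spectrum: the only nonzero eigenvalue is `|Z_A| |Z_{Aᶜ}| / |Z|`, where
`Z_A` consists of the cycles inside `A`. Sending a cycle `x` to the boundary of its part in `A` maps
`Z` onto the common boundaries of chains in `A` and chains in `Aᶜ`, a space of dimension `conn A`,
with kernel `Z_A ⊕ Z_{Aᶜ}`. Hence the entropy is at least `conn A`, and so is the logarithm of the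
rank of the amplitude matrix. A tree tensor network factors that matrix through the bond space of
every tree edge, so claims 1 and 3 both reduce to `exists_le_conn_side`: every subcubic tree has an
edge whose side `A` satisfies `conn A ≥ L`.

Suppose every side has connectivity below `L`. Call the `L + 1` horizontal edges between two
neighbouring columns a band. Explicit cycles paired with functionals on boundaries
(`card_add_card_le_conn`) show that each side misses or contains a whole row, and that a side
missing a row also misses a band. Since a tree has more vertices than edges, some vertex has only
row-missing sides around it (`exists_vertex_of_orientation`). A leaf cannot be such a vertex, so
three sides partition the edges into three colors, each missing a row and having connectivity below
`L`.

No such coloring exists (`not_isBad`). Pockets cut off by a color class can be given that color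
without raising any connectivity, so every class may be assumed to have connected complement. Each
color has a free band, and bands free of different colors are distinct. If color `a` has free bands
on both sides of free bands of `b` and `c`, counting rows on the two sides gives `b` and `c` too
much connectivity in total (`false_of_enclosed`). Otherwise a free band of some color separates the
free bands of the two others, and counting color changes in rows together with occupied bands
overloads those two (`false_of_separated`).

Claim 2 is the same centroid argument, with "less than a third of the qubits" in place of "misses a
row". -/

/-! ### Entanglement of the uniform superposition over a linear code -/

section LinearCode

variable {Q : Type*}

open scoped Classical in
/-- The configuration on `Q` that is `y` on `A` and `z` outside `A`. -/
noncomputable def glue (A : Set Q) (y : A → ZMod 2) (z : {q // q ∉ A} → ZMod 2) : Q → ZMod 2 :=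
  fun q => if h : q ∈ A then y ⟨q, h⟩ else z ⟨q, h⟩

theorem glue_add (A : Set Q) (y y' : A → ZMod 2) (z z' : {q // q ∉ A} → ZMod 2) :
    glue A (y + y') (z + z') = glue A y z + glue A y' z' := by
  funext q; by_cases h : q ∈ A <;> simp [glue, h]

theorem glue_sub (A : Set Q) (y y' : A → ZMod 2) (z z' : {q // q ∉ A} → ZMod 2) :
    glue A (y - y') (z - z') = glue A y z - glue A y' z' := by
  funext q; by_cases h : q ∈ A <;> simp [glue, h]

theorem glue_restrict (A : Set Q) (x : Q → ZMod 2) :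
    glue A (fun q => x q) (fun q => x q) = x := by
  funext q; by_cases h : q ∈ A <;> simp [glue, h]

open scoped Classical in
/-- Splitting a configuration into its parts inside and outside `A`. -/
noncomputable def glueEquiv (A : Set Q) :
    ((A → ZMod 2) × ({q // q ∉ A} → ZMod 2)) ≃ (Q → ZMod 2) where
  toFun p := glue A p.1 p.2
  invFun x := (fun q => x q, fun q => x q)
  left_inv p := by
    ext q
    · simp [glue]
    · simp [glue, q.2]
  right_inv x := glue_restrict A x

variable (Z : Submodule (ZMod 2) (Q → ZMod 2))

open scoped Classical in
/-- The uniform superposition of the codewords of `Z`. -/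
noncomputable def codeState : (Q → ZMod 2) → ℂ :=
  fun x => if x ∈ Z then ((1 / Real.sqrt (Nat.card Z : ℝ) : ℝ) : ℂ) else 0

theorem amplitudeMatrix_apply (ψ : (Q → ZMod 2) → ℂ) (A : Set Q) (y) (z) :
    amplitudeMatrix ψ A y z = ψ (glue A y z) := by
  rfl

/-- The codewords supported in `A`. -/
def codeInside (A : Set Q) : Set (A → ZMod 2) := {y | glue A y 0 ∈ Z}

/-- The codewords supported outside `A`. -/
def codeOutside (A : Set Q) : Set ({q // q ∉ A} → ZMod 2) := {z | glue A 0 z ∈ Z}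

theorem codeState_amp_sq : ((1 / Real.sqrt (Nat.card Z : ℝ) : ℝ) : ℂ) *
    ((1 / Real.sqrt (Nat.card Z : ℝ) : ℝ) : ℂ) = 1 / (Nat.card Z : ℂ) := by
  rw [← Complex.ofReal_mul, div_mul_div_comm, Real.mul_self_sqrt (by positivity)]
  simp

variable [Fintype Q]

theorem codeInside_ncard_pos (A : Set Q) : 0 < (codeInside Z A).ncard :=
  (Set.ncard_pos (Set.toFinite _)).2 ⟨0, by
    have : glue A (0 : A → ZMod 2) 0 = 0 := by funext q; by_cases h : q ∈ A <;> simp [glue, h]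
    simp [codeInside, this]⟩

theorem codeOutside_ncard_pos (A : Set Q) : 0 < (codeOutside Z A).ncard :=
  (Set.ncard_pos (Set.toFinite _)).2 ⟨0, by
    have : glue A (0 : A → ZMod 2) 0 = 0 := by funext q; by_cases h : q ∈ A <;> simp [glue, h]
    simp [codeOutside, this]⟩

theorem natCard_code_pos : 0 < Nat.card Z := Nat.card_pos

open scoped Classical in
theorem sum_codeState_normSq : ∑ x, codeState Z x * star (codeState Z x) = 1 := by
  have h : ∀ x, codeState Z x * star (codeState Z x) = if x ∈ Z then 1 / (Nat.card Z : ℂ) else 0 := by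
    intro x
    by_cases hx : x ∈ Z
    · simp only [codeState, hx, if_true, RCLike.star_def, Complex.conj_ofReal]
      exact codeState_amp_sq Z
    · simp [codeState, hx]
  simp_rw [h]
  rw [← Finset.sum_filter, Finset.sum_const]
  have : (Finset.univ.filter (fun x => x ∈ Z)).card = Nat.card Z := by
    rw [Nat.card_eq_fintype_card, Fintype.card_subtype]
  rw [this, nsmul_eq_mul]
  have : (Nat.card Z : ℂ) ≠ 0 := by exact_mod_cast (natCard_code_pos Z).ne'
  field_simp

/-- The nonzero eigenvalue of the reduced density matrices of `codeState Z`. -/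
noncomputable def codeWeight (A : Set Q) : ℝ :=
  ((codeInside Z A).ncard * (codeOutside Z A).ncard : ℝ) / Nat.card Z

-- Relative to the codeword `(y, z)`, a triple is a translation by one codeword supported outside
-- `A` and one supported inside `A`, chosen independently; linearity puts the remaining corner in
-- the code.
open scoped Classical in
theorem card_triples {A : Set Q} {y : A → ZMod 2} {z : {q // q ∉ A} → ZMod 2}
    (h : glue A y z ∈ Z) :
    (Finset.univ.filter (fun p : ({q // q ∉ A} → ZMod 2) × (A → ZMod 2) =>
      glue A y p.1 ∈ Z ∧ glue A p.2 p.1 ∈ Z ∧ glue A p.2 z ∈ Z)).card =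
      (codeInside Z A).ncard * (codeOutside Z A).ncard := by
  rw [mul_comm, ← Set.ncard_prod, ← Set.ncard_coe_finset]
  refine Set.ncard_congr (fun p _ => (p.1 - z, p.2 - y)) ?_ ?_ ?_
  · rintro ⟨z', y'⟩ hp
    simp only [Finset.coe_filter, Finset.mem_univ, true_and, Set.mem_ofPred_eq] at hp
    refine ⟨?_, ?_⟩
    · have := Z.sub_mem hp.1 h
      rw [← glue_sub, sub_self] at this
      exact this
    · have := Z.sub_mem hp.2.2 h
      rw [← glue_sub, sub_self] at this
      exact this
  · rintro ⟨z', y'⟩ ⟨z'', y''⟩ _ _ he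
    simpa using he
  · rintro ⟨dz, dy⟩ ⟨hz, hy⟩
    refine ⟨(dz + z, dy + y), ?_, by simp⟩
    simp only [Finset.coe_filter, Finset.mem_univ, true_and, Set.mem_ofPred_eq]
    have h1 : glue A y (dz + z) ∈ Z := by
      have := Z.add_mem hz h
      rwa [← glue_add, zero_add] at this
    have h2 : glue A (dy + y) z ∈ Z := by
      have := Z.add_mem hy h
      rwa [← glue_add, zero_add] at this
    refine ⟨h1, ?_, h2⟩
    have := Z.add_mem hy h1
    rwa [← glue_add, zero_add] at this

-- An entry of the triple product counts rectangles with three corners in the code. By linearity the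
-- fourth corner is then a codeword as well, so the product vanishes wherever the amplitude does,
-- and elsewhere the count is constant.
open scoped Classical in
theorem amplitudeMatrix_cube (A : Set Q) :
    amplitudeMatrix (codeState Z) A * (amplitudeMatrix (codeState Z) A).conjTranspose *
      amplitudeMatrix (codeState Z) A = (codeWeight Z A : ℂ) • amplitudeMatrix (codeState Z) A := by
  set c : ℂ := ((1 / Real.sqrt (Nat.card Z : ℝ) : ℝ) : ℂ) with hc
  have hcc : star c = c := by simp [hc]
  ext y z
  have key : ∀ (z' : {q // q ∉ A} → ZMod 2) (y' : A → ZMod 2),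
      amplitudeMatrix (codeState Z) A y z' * star (amplitudeMatrix (codeState Z) A y' z') *
        amplitudeMatrix (codeState Z) A y' z =
      if glue A y z' ∈ Z ∧ glue A y' z' ∈ Z ∧ glue A y' z ∈ Z then c * c * c else 0 := by
    intro z' y'
    simp only [amplitudeMatrix_apply, codeState, ← hc]
    by_cases h1 : glue A y z' ∈ Z <;> by_cases h2 : glue A y' z' ∈ Z <;>
      by_cases h3 : glue A y' z ∈ Z <;> simp [h1, h2, h3, hcc]
  have hsum : (amplitudeMatrix (codeState Z) A * (amplitudeMatrix (codeState Z) A).conjTranspose *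
      amplitudeMatrix (codeState Z) A) y z =
      ∑ p : ({q // q ∉ A} → ZMod 2) × (A → ZMod 2),
        if glue A y p.1 ∈ Z ∧ glue A p.2 p.1 ∈ Z ∧ glue A p.2 z ∈ Z then c * c * c else 0 := by
    rw [Fintype.sum_prod_type_right]
    simp only [Matrix.mul_apply, Matrix.conjTranspose_apply, Finset.sum_mul, key]
  rw [hsum, ← Finset.sum_filter, Finset.sum_const, Matrix.smul_apply, amplitudeMatrix_apply]
  by_cases h : glue A y z ∈ Z
  · rw [card_triples Z h, codeState_amp_sq Z]
    simp only [codeState, h, if_true, ← hc, codeWeight, nsmul_eq_mul, smul_eq_mul]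
    push_cast
    ring
  · rw [Finset.filter_false_of_mem]
    · simp [codeState, h]
    · rintro ⟨z', y'⟩ _ ⟨h1, h2, h3⟩
      refine h ?_
      have := Z.add_mem (Z.sub_mem h1 h2) h3
      rw [← glue_sub, ← glue_add] at this
      simpa using this

open scoped Classical in
theorem reducedDensity_sq (A : Set Q) :
    reducedDensity (codeState Z) A * reducedDensity (codeState Z) A =
      (codeWeight Z A : ℂ) • reducedDensity (codeState Z) A := by
  unfold reducedDensity
  rw [← Matrix.mul_assoc, amplitudeMatrix_cube, Matrix.smul_mul]

open scoped Classical in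
theorem trace_reducedDensity (A : Set Q) : (reducedDensity (codeState Z) A).trace = 1 := by
  rw [← sum_codeState_normSq Z, ← (glueEquiv A).sum_comp, Fintype.sum_prod_type]
  simp only [reducedDensity, Matrix.trace, Matrix.diag_apply, Matrix.mul_apply,
    Matrix.conjTranspose_apply, amplitudeMatrix_apply]
  rfl

open scoped Classical in
theorem codeState_eigenvalues (A : Set Q) (i) :
    (reducedDensity_isHermitian (codeState Z) A).eigenvalues i = 0 ∨
    (reducedDensity_isHermitian (codeState Z) A).eigenvalues i = codeWeight Z A := by
  set H := reducedDensity_isHermitian (codeState Z) A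
  have h1 := H.mulVec_eigenvectorBasis i
  have h2 : (reducedDensity (codeState Z) A * reducedDensity (codeState Z) A).mulVec
      (⇑(H.eigenvectorBasis i)) =
      ((codeWeight Z A : ℂ) • reducedDensity (codeState Z) A).mulVec (⇑(H.eigenvectorBasis i)) := by
    rw [reducedDensity_sq]
  rw [← Matrix.mulVec_mulVec, h1, Matrix.mulVec_smul, h1, Matrix.smul_mulVec, h1] at h2
  have hne : ⇑(H.eigenvectorBasis i) ≠ 0 := by
    intro h0
    have := H.eigenvectorBasis.orthonormal.ne_zero i
    apply this
    ext j
    exact congrFun h0 j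
  obtain ⟨j, hj⟩ := Function.ne_iff.1 hne
  have h3 := congrFun h2 j
  simp only [Pi.smul_apply, Complex.real_smul, smul_eq_mul] at h3
  have hj' : (H.eigenvectorBasis i).ofLp j ≠ 0 := hj
  have h4 : ((H.eigenvalues i : ℂ)) * (H.eigenvalues i - codeWeight Z A) = 0 := by
    apply mul_right_cancel₀ hj'
    linear_combination h3
  rcases mul_eq_zero.1 h4 with h | h
  · left; exact_mod_cast h
  · right; rw [sub_eq_zero] at h; exact_mod_cast h

-- Every nonzero eigenvalue is the same weight `w`, and the eigenvalues sum to `1`, so `∑ λ log λ =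
-- log w`; the multiplicity is never needed.
open scoped Classical in
theorem entanglementEntropy_codeState (A : Set Q) :
    entanglementEntropy (codeState Z) A = -Real.logb 2 (codeWeight Z A) := by
  have htr : ∑ i, (reducedDensity_isHermitian (codeState Z) A).eigenvalues i = 1 := by
    have h : (1 : ℂ) =
        ∑ i, (((reducedDensity_isHermitian (codeState Z) A).eigenvalues i : ℝ) : ℂ) := by
      rw [← trace_reducedDensity Z A]
      exact (reducedDensity_isHermitian (codeState Z) A).trace_eq_sum_eigenvalues
    exact_mod_cast h.symm
  unfold entanglementEntropy
  rw [neg_inj, ← one_mul (Real.logb 2 (codeWeight Z A)), ← htr, Finset.sum_mul]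
  refine Finset.sum_congr rfl fun i _ => ?_
  rcases codeState_eigenvalues Z A i with h | h <;> simp [h]

theorem le_entanglementEntropy_codeState (A : Set Q) (k : ℕ)
    (h : 2 ^ k * ((codeInside Z A).ncard * (codeOutside Z A).ncard) ≤ Nat.card Z) :
    (k : ℝ) ≤ entanglementEntropy (codeState Z) A := by
  rw [entanglementEntropy_codeState]
  have h1 := codeInside_ncard_pos Z A
  have h2 := codeOutside_ncard_pos Z A
  have h3 := natCard_code_pos Z
  have hw : 0 < codeWeight Z A := by unfold codeWeight; positivity
  rw [le_neg, Real.logb_le_iff_le_rpow (by norm_num) hw, Real.rpow_neg (by norm_num),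
    Real.rpow_natCast, codeWeight, div_le_iff₀ (by exact_mod_cast h3), ← div_eq_inv_mul,
    le_div_iff₀ (by positivity)]
  have : ((2 ^ k * ((codeInside Z A).ncard * (codeOutside Z A).ncard) : ℕ) : ℝ) ≤ Nat.card Z := by
    exact_mod_cast h
  push_cast at this
  linarith

end LinearCode

/-! ### Chains, boundaries and the connectivity space of an edge set -/

section Chains

variable {V : Type*} {G : SimpleGraph V}

open scoped Classical in
/-- The restriction of a chain to a set of edges. -/
noncomputable def restr (A : Set G.edgeSet) (x : G.edgeSet → ZMod 2) : G.edgeSet → ZMod 2 :=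
  fun e => if e ∈ A then x e else 0

/-- The chains supported in `A`. -/
def chainsIn (A : Set G.edgeSet) : Submodule (ZMod 2) (G.edgeSet → ZMod 2) where
  carrier := {x | ∀ e ∉ A, x e = 0}
  add_mem' ha hb e he := by simp [ha e he, hb e he]
  zero_mem' e _ := rfl
  smul_mem' c x hx e he := by simp [hx e he]

theorem restr_apply_mem {A : Set G.edgeSet} (x : G.edgeSet → ZMod 2) {e : G.edgeSet} (he : e ∈ A) :
    restr A x e = x e := by simp [restr, he]

theorem restr_apply_notMem {A : Set G.edgeSet} (x : G.edgeSet → ZMod 2) {e : G.edgeSet}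
    (he : e ∉ A) : restr A x e = 0 := by simp [restr, he]

theorem restr_mem (A : Set G.edgeSet) (x : G.edgeSet → ZMod 2) : restr A x ∈ chainsIn A :=
  fun _ he => restr_apply_notMem x he

theorem restr_add_restr_compl (A : Set G.edgeSet) (x : G.edgeSet → ZMod 2) :
    restr A x + restr Aᶜ x = x := by
  funext e; by_cases h : e ∈ A <;> simp [restr, h]

theorem restr_of_mem {A : Set G.edgeSet} {x : G.edgeSet → ZMod 2} (h : x ∈ chainsIn A) :
    restr A x = x := by
  funext e; by_cases he : e ∈ A
  · simp [restr, he]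
  · simp [restr, he, h e he]

theorem restr_of_mem_compl {A : Set G.edgeSet} {x : G.edgeSet → ZMod 2} (h : x ∈ chainsIn Aᶜ) :
    restr A x = 0 := by
  funext e; by_cases he : e ∈ A
  · simp [restr, he, h e (by simpa using he)]
  · simp [restr, he]

theorem restr_add (A : Set G.edgeSet) (x y : G.edgeSet → ZMod 2) :
    restr A (x + y) = restr A x + restr A y := by
  funext e; by_cases he : e ∈ A <;> simp [restr, he]

theorem chainsIn_mono {A B : Set G.edgeSet} (h : A ⊆ B) : chainsIn A ≤ chainsIn B :=
  fun _ hx e he => hx e fun h' => he (h h')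

theorem add_self_chain {α : Type*} (x : α → ZMod 2) : x + x = 0 :=
  funext fun _ => CharTwo.add_self_eq_zero _

theorem eq_of_add_eq_zero_chain {α : Type*} {x y : α → ZMod 2} (h : x + y = 0) : x = y := by
  have : x + y + y = y := by rw [h, zero_add]
  rwa [add_assoc, add_self_chain, add_zero] at this

theorem restr_glue (A : Set G.edgeSet) (y : A → ZMod 2) (z : {q // q ∉ A} → ZMod 2) :
    restr A (glue A y z) = glue A y 0 := by
  funext e; by_cases he : e ∈ A <;> simp [restr, glue, he]

variable [Fintype G.edgeSet]

open scoped Classical in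
variable (G) in
/-- The boundary of a `1`-chain modulo `2`. -/
noncomputable def bd : (G.edgeSet → ZMod 2) →ₗ[ZMod 2] (V → ZMod 2) where
  toFun x s := ∑ e ∈ Finset.univ.filter (fun e : G.edgeSet => s ∈ (e : Sym2 V)), x e
  map_add' x y := by funext s; simp [Finset.sum_add_distrib]
  map_smul' c x := by funext s; simp [Finset.mul_sum]

open scoped Classical in
theorem bd_apply (x : G.edgeSet → ZMod 2) (s : V) :
    bd G x s = ∑ e ∈ Finset.univ.filter (fun e : G.edgeSet => s ∈ (e : Sym2 V)), x e := rfl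

theorem bd_apply_eq_zero {x : G.edgeSet → ZMod 2} {s : V}
    (h : ∀ e : G.edgeSet, s ∈ (e : Sym2 V) → x e = 0) : bd G x s = 0 := by
  classical
  rw [bd_apply]
  exact Finset.sum_eq_zero fun e he => h e (Finset.mem_filter.1 he).2

theorem bd_apply_eq_single {x : G.edgeSet → ZMod 2} {s : V} {e₀ : G.edgeSet}
    (h₀ : s ∈ (e₀ : Sym2 V))
    (h : ∀ e : G.edgeSet, s ∈ (e : Sym2 V) → e ≠ e₀ → x e = 0) : bd G x s = x e₀ := by
  classical
  rw [bd_apply]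
  refine Finset.sum_eq_single e₀ (fun e he hne => h e (Finset.mem_filter.1 he).2 hne) ?_
  intro h'; exact absurd (Finset.mem_filter.2 ⟨Finset.mem_univ e₀, h₀⟩) h'

theorem bd_apply_eq_sum {x : G.edgeSet → ZMod 2} {s : V} (S : Finset G.edgeSet)
    (hS : ∀ e ∈ S, s ∈ (e : Sym2 V))
    (h : ∀ e : G.edgeSet, s ∈ (e : Sym2 V) → e ∉ S → x e = 0) : bd G x s = ∑ e ∈ S, x e := by
  classical
  rw [bd_apply]
  symm
  exact Finset.sum_subset (fun e he => Finset.mem_filter.2 ⟨Finset.mem_univ _, hS e he⟩)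
    fun e he hne => h e (Finset.mem_filter.1 he).2 hne

theorem bd_single [DecidableEq V] [DecidableEq G.edgeSet] {u v : V} (h : G.Adj u v) :
    bd G (Pi.single ⟨s(u, v), h⟩ 1) = Pi.single u 1 + Pi.single v 1 := by
  funext s
  rw [Pi.add_apply, Pi.single_apply, Pi.single_apply]
  have huv : u ≠ v := h.ne
  by_cases hs : s ∈ s(u, v)
  · rw [bd_apply_eq_single (e₀ := ⟨s(u, v), h⟩) hs (fun e _ hne => by simp [hne])]
    rcases Sym2.mem_iff.1 hs with rfl | rfl
    · simp [huv]
    · simp [huv.symm]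
  · rw [bd_apply_eq_zero]
    · rw [Sym2.mem_iff, not_or] at hs
      simp [hs.1, hs.2]
    · intro e he
      have : e ≠ ⟨s(u, v), h⟩ := by rintro rfl; exact hs he
      simp [this]

variable (G) in
/-- The cycle space. -/
noncomputable def cycles : Submodule (ZMod 2) (G.edgeSet → ZMod 2) := LinearMap.ker (bd G)

theorem mem_cycles {x : G.edgeSet → ZMod 2} : x ∈ cycles G ↔ bd G x = 0 := LinearMap.mem_ker

/-- The common boundaries of chains in `A` and chains outside `A`; its dimension is the
connectivity `r(A) + r(Aᶜ) - r(E)` of the cycle matroid. -/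
noncomputable def connSpace (A : Set G.edgeSet) : Submodule (ZMod 2) (V → ZMod 2) :=
  (chainsIn A).map (bd G) ⊓ (chainsIn Aᶜ).map (bd G)

/-- The connectivity function of the cycle matroid of `G`. -/
noncomputable def conn (A : Set G.edgeSet) : ℕ := Module.finrank (ZMod 2) (connSpace A)

theorem conn_compl (A : Set G.edgeSet) : conn Aᶜ = conn A := by
  unfold conn connSpace
  rw [compl_compl, inf_comm]

theorem bd_restr_compl {x : G.edgeSet → ZMod 2} (A : Set G.edgeSet) (hx : x ∈ cycles G) :
    bd G (restr Aᶜ x) = bd G (restr A x) := by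
  have := mem_cycles.1 hx
  rw [← restr_add_restr_compl A x, map_add] at this
  exact (eq_of_add_eq_zero_chain this).symm

/-- A cycle has the same boundary on both sides of a bipartition. This common boundary is all the
information the two parts share, and it labels the blocks of the amplitude matrix. -/
theorem bd_restr_mem_connSpace {x : G.edgeSet → ZMod 2} (A : Set G.edgeSet) (hx : x ∈ cycles G) :
    bd G (restr A x) ∈ connSpace A :=
  ⟨⟨_, restr_mem A x, rfl⟩, ⟨_, restr_mem Aᶜ x, bd_restr_compl A hx⟩⟩

theorem exists_cycle_of_mem_connSpace {A : Set G.edgeSet} {f : V → ZMod 2}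
    (hf : f ∈ connSpace A) : ∃ x ∈ cycles G, bd G (restr A x) = f := by
  obtain ⟨⟨x, hx, rfl⟩, ⟨y, hy, hxy⟩⟩ := hf
  refine ⟨x + y, ?_, ?_⟩
  · rw [mem_cycles, map_add, hxy, add_self_chain]
  · rw [restr_add, restr_of_mem hx, restr_of_mem_compl hy, add_zero]

theorem natCard_connSpace [Finite V] (A : Set G.edgeSet) :
    Nat.card (connSpace A) = 2 ^ conn A := by
  rw [Module.natCard_eq_pow_finrank (K := ZMod 2), Nat.card_zmod]; rfl

/-- Each common boundary is lifted to a cycle, then translated by cycles inside and outside `A`.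
Translation does not change the boundary of the part in `A`, so the boundary, and then both
translations, can be recovered. -/
theorem two_pow_conn_mul_le [Finite V] (A : Set G.edgeSet) :
    2 ^ conn A * ((codeInside (cycles G) A).ncard * (codeOutside (cycles G) A).ncard) ≤
      Nat.card (cycles G) := by
  classical
  rw [← natCard_connSpace, ← Nat.card_coe_set_eq, ← Nat.card_coe_set_eq, ← Nat.card_prod,
    ← Nat.card_prod]
  choose s hs hs' using fun f : connSpace A => exists_cycle_of_mem_connSpace f.2
  have hglue : ∀ (y : codeInside (cycles G) A) (z : codeOutside (cycles G) A),
      glue A y.1 z.1 = glue A y.1 0 + glue A 0 z.1 := by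
    intro y z; rw [← glue_add]; simp
  have hmem : ∀ (y : codeInside (cycles G) A) (z : codeOutside (cycles G) A),
      glue A y.1 z.1 ∈ cycles G := by
    intro y z
    rw [hglue]
    exact (cycles G).add_mem y.2 z.2
  refine Nat.card_le_card_of_injective
    (fun p : connSpace A × (codeInside (cycles G) A × codeOutside (cycles G) A) =>
      (⟨s p.1 + glue A p.2.1.1 p.2.2.1, (cycles G).add_mem (hs _) (hmem _ _)⟩ : cycles G)) ?_
  rintro ⟨f, y, z⟩ ⟨f', y', z'⟩ h
  have h : s f + glue A y.1 z.1 = s f' + glue A y'.1 z'.1 := congrArg Subtype.val h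
  have hb : ∀ (f : connSpace A) (y : codeInside (cycles G) A) (z : codeOutside (cycles G) A),
      bd G (restr A (s f + glue A y.1 z.1)) = f := by
    intro f y z
    rw [restr_add, map_add, hs', restr_glue, mem_cycles.1 y.2, add_zero]
  have hf : f = f' := Subtype.ext (by rw [← hb f y z, h, hb])
  subst hf
  have h2 := add_left_cancel h
  have h3 := (glueEquiv A).injective (a₁ := (y.1, z.1)) (a₂ := (y'.1, z'.1)) h2
  simp only [Prod.mk.injEq] at h3
  rw [Subtype.ext h3.1, Subtype.ext h3.2]

theorem planarCodeState_eq [Fintype V] : planarCodeState G = codeState (cycles G) := by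
  funext x
  have key : ∀ (Z : Set (G.edgeSet → ZMod 2)) (_ : Decidable (x ∈ Z)),
      (∀ x, x ∈ Z ↔ x ∈ cycles G) →
      (if x ∈ Z then ((1 / Real.sqrt (Z.ncard : ℝ) : ℝ) : ℂ) else 0) =
        codeState (cycles G) x := by
    intro Z _ h
    obtain rfl : Z = (cycles G : Set (G.edgeSet → ZMod 2)) := Set.ext h
    by_cases hx : x ∈ cycles G <;> simp [codeState, SetLike.mem_coe, hx, ← Nat.card_coe_set_eq]
  unfold planarCodeState
  refine key _ _ fun x => ?_
  rw [mem_cycles, funext_iff, Set.mem_ofPred_eq]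
  refine forall_congr' fun s => ?_
  rw [Pi.zero_apply, bd_apply]
  convert Iff.rfl

theorem conn_le_entanglementEntropy [Fintype V] (A : Set G.edgeSet) :
    (conn A : ℝ) ≤ entanglementEntropy (planarCodeState G) A := by
  rw [planarCodeState_eq]
  exact le_entanglementEntropy_codeState _ _ _ (two_pow_conn_mul_le A)

/-- A factorization of the amplitude matrix through a `D`-dimensional space needs
`2 ^ conn A ≤ D`. -/
theorem two_pow_conn_le_of_factorization [Fintype V] (A : Set G.edgeSet) {D : ℕ}
    (F : (A → ZMod 2) → Fin D → ℂ) (H : Fin D → ({q // q ∉ A} → ZMod 2) → ℂ)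
    (h : ∀ y z, amplitudeMatrix (planarCodeState G) A y z = ∑ k, F y k * H k z) :
    2 ^ conn A ≤ D := by
  classical
  rw [planarCodeState_eq] at h
  choose s hs hs' using fun f : connSpace A => exists_cycle_of_mem_connSpace f.2
  have : Fintype (connSpace A) := Fintype.ofFinite _
  set c : ℂ := ((1 / Real.sqrt (Nat.card (cycles G) : ℝ) : ℝ) : ℂ) with hc
  have hc0 : c ≠ 0 := by
    have := natCard_code_pos (cycles G)
    simp only [hc, ne_eq, Complex.ofReal_eq_zero]
    positivity
  -- Joining the inner part of the cycle lifting `f` to the outer part of the one lifting `g` gives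
  -- a cycle only when `f = g`. The amplitude matrix thus contains a scalar matrix of size `2 ^ conn
  -- A`.
  have hmul : (Matrix.of fun (f : connSpace A) k => F (fun q => s f q) k) *
      (Matrix.of fun k (g : connSpace A) => H k (fun q => s g q)) =
      c • (1 : Matrix (connSpace A) (connSpace A) ℂ) := by
    ext f g
    rw [Matrix.mul_apply, Matrix.smul_apply, Matrix.one_apply]
    simp only [Matrix.of_apply]
    rw [← h, amplitudeMatrix_apply, codeState, ← hc]
    have hg : glue A (fun q => s f q) (fun q => s g q) = restr A (s f) + restr Aᶜ (s g) := by
      funext e; by_cases he : e ∈ A <;> simp [restr, glue, he]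
    have hiff : glue A (fun q => s f q) (fun q => s g q) ∈ cycles G ↔ f = g := by
      rw [hg, mem_cycles, map_add, bd_restr_compl A (hs g), hs', hs']
      constructor
      · exact fun h => Subtype.ext (eq_of_add_eq_zero_chain h)
      · rintro rfl; exact add_self_chain _
    simp only [hiff]
    by_cases hfg : f = g <;> simp [hfg]
  have hr : (c • (1 : Matrix (connSpace A) (connSpace A) ℂ)).rank = Fintype.card (connSpace A) :=
    Matrix.rank_of_isUnit _ (by
      rw [Matrix.isUnit_iff_isUnit_det, Matrix.det_smul, Matrix.det_one, mul_one]
      exact (pow_ne_zero _ hc0).isUnit)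
  have h1 := Matrix.rank_mul_le_left (Matrix.of fun (f : connSpace A) k => F (fun q => s f q) k)
      (Matrix.of fun k (g : connSpace A) => H k (fun q => s g q))
  rw [hmul, hr] at h1
  have h2 := h1.trans (Matrix.rank_le_card_width _)
  rw [Fintype.card_fin] at h2
  rwa [← Nat.card_eq_fintype_card, natCard_connSpace] at h2

/-- The connectivity function is monotone under splitting off a vertex-disjoint part. -/
theorem conn_le_of_disjoint_vertices [Finite V] {A X Y : Set G.edgeSet} (hA : A = X ∪ Y)
    (hXY : ∀ e ∈ X, ∀ e' ∈ Y, ∀ v, v ∈ (e : Sym2 V) → v ∉ (e' : Sym2 V)) :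
    conn X ≤ conn A := by
  classical
  subst hA
  let ρ : (V → ZMod 2) →ₗ[ZMod 2] (V → ZMod 2) :=
    { toFun := fun f v => if ∃ e ∈ X, v ∈ (e : Sym2 V) then f v else 0
      map_add' := fun f g => by funext v; dsimp only [Pi.add_apply]; split_ifs <;> simp
      map_smul' := fun c f => by funext v; dsimp only [Pi.smul_apply]; split_ifs <;> simp }
  have hle : connSpace X ≤ (connSpace (X ∪ Y)).map ρ := by
    rintro f ⟨⟨x, hx, rfl⟩, ⟨y, hy, hxy⟩⟩
    -- With `∂x = ∂y`, moving the part of `y` in `Y` to the other side gives a common boundary for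
    -- `X ∪ Y`. It agrees with `∂x` on the vertices of `X`, because `Y` touches none of them.
    refine ⟨bd G (x + restr Y y), ⟨⟨_, ?_, rfl⟩, ⟨restr (X ∪ Y)ᶜ y, restr_mem _ _, ?_⟩⟩, ?_⟩
    · exact (chainsIn _).add_mem (chainsIn_mono Set.subset_union_left hx)
        (chainsIn_mono Set.subset_union_right (restr_mem Y y))
    · have : y = restr Y y + restr (X ∪ Y)ᶜ y := by
        funext e
        by_cases h1 : e ∈ X
        · have h2 : e ∉ Y := by
            intro h2
            obtain ⟨v, hv⟩ : ∃ v, v ∈ (e : Sym2 V) := ⟨_, Sym2.out_fst_mem _⟩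
            exact hXY e h1 e h2 v hv hv
          simp [restr, h1, h2, hy e (by simpa using h1)]
        · by_cases h2 : e ∈ Y <;> simp [restr, h1, h2]
      have h2 := congrArg (bd G) this
      rw [map_add] at h2
      rw [map_add, ← hxy, h2, add_right_comm, add_self_chain, zero_add]
    · funext v
      change (if ∃ e ∈ X, v ∈ (e : Sym2 V) then bd G (x + restr Y y) v else 0) = _
      split_ifs with hv
      · obtain ⟨e, he, hve⟩ := hv
        rw [map_add, Pi.add_apply, bd_apply_eq_zero (x := restr Y y), add_zero]
        intro e' he'
        exact restr_apply_notMem _ fun hY => hXY e he e' hY v hve he'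
      · symm
        apply bd_apply_eq_zero
        intro e he
        exact hx e fun heX => hv ⟨e, heX, he⟩
  exact (Submodule.finrank_mono hle).trans (Submodule.finrank_map_le _ _)

/-- Lower bounds for the connectivity by dual families. -/
theorem le_conn_of_dual [Finite V] {ι κ : Type*} [Fintype ι] [Fintype κ] [DecidableEq ι]
    [DecidableEq κ] (A : Set G.edgeSet)
    (f : ι → G.edgeSet → ZMod 2) (g : κ → G.edgeSet → ZMod 2)
    (hf : ∀ i, f i ∈ cycles G) (hg : ∀ j, g j ∈ cycles G)
    (φ : ι → (V → ZMod 2) →ₗ[ZMod 2] ZMod 2) (ψ : κ → (V → ZMod 2) →ₗ[ZMod 2] ZMod 2)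
    (hff : ∀ i i', φ i (bd G (restr A (f i'))) = if i = i' then 1 else 0)
    (hfg : ∀ i j, φ i (bd G (restr A (g j))) = 0)
    (hgg : ∀ j j', ψ j (bd G (restr A (g j'))) = if j = j' then 1 else 0) :
    Fintype.card ι + Fintype.card κ ≤ conn A := by
  rw [← Fintype.card_sum]
  let F : ι ⊕ κ → connSpace A :=
    Sum.elim (fun i => ⟨_, bd_restr_mem_connSpace A (hf i)⟩)
      (fun j => ⟨_, bd_restr_mem_connSpace A (hg j)⟩)
  refine LinearIndependent.fintype_card_le_finrank (R := ZMod 2) (b := F) ?_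
  rw [Fintype.linearIndependent_iff]
  intro a ha
  have ha' : ∑ i, a (Sum.inl i) • bd G (restr A (f i)) +
      ∑ j, a (Sum.inr j) • bd G (restr A (g j)) = 0 := by
    have := congrArg Subtype.val ha
    simpa [Fintype.sum_sum_type, F] using this
  -- The pairing is block triangular: `φ` kills the family `g`, while nothing is assumed about `ψ`
  -- on `f`. The coefficients of `f` must therefore be eliminated first.
  have h1 : ∀ i, a (Sum.inl i) = 0 := by
    intro i
    have := congrArg (φ i) ha'
    simpa [hff, hfg] using this
  have h2 : ∀ j, a (Sum.inr j) = 0 := by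
    intro j
    have := congrArg (ψ j) ha'
    simpa [h1, hgg] using this
  rintro (i | j)
  · exact h1 i
  · exact h2 j

end Chains

/-! ### Branches of a tree -/

section Branch

variable {V : Type*} {G : SimpleGraph V}

theorem reachable_fst_or_snd (hG : G.Connected) (d : G.Dart) (w : V) :
    (G.deleteEdges {d.edge}).Reachable d.fst w ∨ (G.deleteEdges {d.edge}).Reachable d.snd w := by
  obtain ⟨p⟩ := hG d.fst w
  suffices h : ∀ (a b : V) (p : G.Walk a b),
      ((G.deleteEdges {d.edge}).Reachable d.fst a ∨ (G.deleteEdges {d.edge}).Reachable d.snd a) →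
      ((G.deleteEdges {d.edge}).Reachable d.fst b ∨ (G.deleteEdges {d.edge}).Reachable d.snd b) from
    h _ _ p (Or.inl (SimpleGraph.Reachable.refl _))
  intro a b p
  induction p with
  | nil => exact id
  | @cons x y z h p ih =>
    intro hx
    refine ih ?_
    by_cases he : s(x, y) = d.edge
    · have hy : y ∈ d.edge := by rw [← he]; exact Sym2.mem_mk_right _ _
      have hy' : y ∈ s(d.fst, d.snd) := hy
      rcases Sym2.mem_iff.1 hy' with rfl | rfl
      · exact Or.inl (SimpleGraph.Reachable.refl _)
      · exact Or.inr (SimpleGraph.Reachable.refl _)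
    · have hadj : (G.deleteEdges {d.edge}).Adj x y := by
        rw [SimpleGraph.deleteEdges_adj]; exact ⟨h, he⟩
      exact hx.imp (fun h => h.trans hadj.reachable) (fun h => h.trans hadj.reachable)

theorem not_reachable_fst_snd (hG : G.IsAcyclic) (d : G.Dart) :
    ¬ (G.deleteEdges {d.edge}).Reachable d.fst d.snd :=
  SimpleGraph.isAcyclic_iff_forall_adj_isBridge.1 hG d.adj

/-- The dart is the first edge of a path from `v` to `w`, reversed; the rest of the path never
returns to `v`, so it avoids that edge. -/
theorem exists_dart_reachable (hG : G.Connected) {v w : V} (hvw : w ≠ v) :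
    ∃ d : G.Dart, d.snd = v ∧ (G.deleteEdges {d.edge}).Reachable d.fst w := by
  obtain ⟨p, hp⟩ := hG.preconnected.exists_isPath v w
  cases p with
  | nil => exact absurd rfl hvw
  | @cons _ u _ h q =>
    refine ⟨⟨(u, v), h.symm⟩, rfl, ⟨q.toDeleteEdges _ ?_⟩⟩
    intro e he heq
    have hv := ((SimpleGraph.Walk.cons_isPath_iff _ _).1 hp).2
    rw [Set.mem_singleton_iff] at heq
    subst heq
    exact hv (q.snd_mem_support_of_mem_edges he)

/-- Two different branches at `v` sharing `w` would close a cycle: a walk inside the first branch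
avoids `v`, hence avoids the edge of `d'`, and so joins `d'.fst` to `v` without that edge. -/
theorem eq_of_reachable_branches (hG : G.IsAcyclic) {d d' : G.Dart} (h : d.snd = d'.snd) {w : V}
    (hd : (G.deleteEdges {d.edge}).Reachable d.fst w)
    (hd' : (G.deleteEdges {d'.edge}).Reachable d'.fst w) : d = d' := by
  classical
  by_contra hne
  have hedge : d.edge ≠ d'.edge := by
    intro he
    rcases (SimpleGraph.dart_edge_eq_iff d d').1 he with h1 | h1
    · exact hne h1
    · subst h1
      exact d'.snd_ne_fst h.symm
  obtain ⟨p⟩ := hd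
  have hv : d.snd ∉ p.support := fun hv =>
    not_reachable_fst_snd hG d ⟨p.takeUntil _ hv⟩
  have hp : (G.deleteEdges {d'.edge}).Reachable d.fst w := by
    refine ⟨p.transfer _ ?_⟩
    intro e he
    have h1 : e ∈ (G.deleteEdges {d.edge}).edgeSet := p.edges_subset_edgeSet he
    rw [SimpleGraph.edgeSet_deleteEdges] at h1 ⊢
    refine ⟨h1.1, ?_⟩
    rintro rfl
    apply hv
    rw [h]
    exact p.snd_mem_support_of_mem_edges he
  apply not_reachable_fst_snd hG d'
  refine hd'.trans (hp.symm.trans ?_)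
  have : (G.deleteEdges {d'.edge}).Adj d.fst d.snd := by
    rw [SimpleGraph.deleteEdges_adj]; exact ⟨d.adj, hedge⟩
  rw [← h]
  exact this.reachable

end Branch

namespace SubcubicTree

variable {Q : Type*} (T : SubcubicTree Q)

theorem mem_side {d : T.graph.Dart} {q : Q} :
    q ∈ T.side d ↔ (T.graph.deleteEdges {d.edge}).Reachable d.fst (T.leaf q : T.V) := Iff.rfl

theorem side_symm (d : T.graph.Dart) : T.side d.symm = (T.side d)ᶜ := by
  ext q
  rw [Set.mem_compl_iff, mem_side, mem_side, SimpleGraph.Dart.edge_symm]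
  constructor
  · intro h h'
    exact not_reachable_fst_snd T.isTree.isAcyclic d (h'.trans h.symm)
  · intro h
    exact (reachable_fst_or_snd T.isTree.connected d _).resolve_left h

theorem exists_side_of_ne {v : T.V} {q : Q} (h : (T.leaf q : T.V) ≠ v) :
    ∃ d : T.graph.Dart, d.snd = v ∧ q ∈ T.side d :=
  exists_dart_reachable T.isTree.connected h

theorem eq_of_mem_sides {d d' : T.graph.Dart} (h : d.snd = d'.snd) {q : Q}
    (hd : q ∈ T.side d) (hd' : q ∈ T.side d') : d = d' :=
  eq_of_reachable_branches T.isTree.isAcyclic h hd hd'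

theorem notMem_side_of_leaf_eq {d : T.graph.Dart} {q : Q} (h : (T.leaf q : T.V) = d.snd) :
    q ∉ T.side d := by
  rw [mem_side, h]
  exact not_reachable_fst_snd T.isTree.isAcyclic d

/-- If for every tree edge one of the two sides is small, then some vertex has only small sides
around it. -/
theorem exists_vertex_of_orientation (P : Set Q → Prop)
    (h : ∀ d : T.graph.Dart, P (T.side d) ∨ P (T.side d)ᶜ) :
    ∃ v : T.V, ∀ d : T.graph.Dart, d.snd = v → P (T.side d) := by
  classical
  by_contra hcon
  -- Otherwise every vertex picks an incoming edge with a large side. A tree has one more vertex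
  -- than edges, so two vertices pick the same edge from opposite ends, and both of its sides are
  -- large.
  push Not at hcon
  choose d hd hP using hcon
  have hcard := T.isTree.card_edgeFinset
  obtain ⟨u, -, v, -, huv, he⟩ := Finset.exists_ne_map_eq_of_card_lt_of_maps_to
    (s := Finset.univ) (t := T.graph.edgeFinset) (f := fun v => (d v).edge)
    (by rw [Finset.card_univ]; omega)
    (fun v _ => by simp)
  rcases (SimpleGraph.dart_edge_eq_iff _ _).1 he with h1 | h1
  · exact huv (by rw [← hd u, ← hd v, h1])
  · have h2 : T.side (d u) = (T.side (d v))ᶜ := by rw [h1, side_symm]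
    rcases h (d v) with h3 | h3
    · exact hP v h3
    · exact hP u (h2 ▸ h3)

/-- At an inner vertex the three sides partition the qubits. -/
theorem exists_three_sides {v : T.V} (hv : (T.graph.neighborSet v).ncard = 3) :
    ∃ d : Fin 3 → T.graph.Dart, (∀ i, (d i).snd = v) ∧
      ∀ q, ∃! i, q ∈ T.side (d i) := by
  obtain ⟨a, b, c, hab, hac, hbc, hs⟩ := Set.ncard_eq_three.1 hv
  have ha : T.graph.Adj v a := by
    have : a ∈ T.graph.neighborSet v := by rw [hs]; simp
    exact this
  have hb : T.graph.Adj v b := by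
    have : b ∈ T.graph.neighborSet v := by rw [hs]; simp
    exact this
  have hc : T.graph.Adj v c := by
    have : c ∈ T.graph.neighborSet v := by rw [hs]; simp
    exact this
  refine ⟨![⟨(a, v), ha.symm⟩, ⟨(b, v), hb.symm⟩, ⟨(c, v), hc.symm⟩], ?_, ?_⟩
  · intro i; fin_cases i <;> rfl
  · intro q
    have hq : (T.leaf q : T.V) ≠ v := by
      rintro rfl
      have := (T.leaf q).2
      omega
    obtain ⟨d, hd, hqd⟩ := T.exists_side_of_ne hq
    have hfst : d.fst ∈ T.graph.neighborSet v := by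
      rw [← hd]; exact d.adj.symm
    have hd' : ∃ i, d = (![⟨(a, v), ha.symm⟩, ⟨(b, v), hb.symm⟩, ⟨(c, v), hc.symm⟩] :
        Fin 3 → T.graph.Dart) i := by
      rw [hs] at hfst
      rcases hfst with h | h | h
      · exact ⟨0, SimpleGraph.Dart.ext _ _ (Prod.ext h hd)⟩
      · exact ⟨1, SimpleGraph.Dart.ext _ _ (Prod.ext h hd)⟩
      · exact ⟨2, SimpleGraph.Dart.ext _ _ (Prod.ext h hd)⟩
    obtain ⟨i, rfl⟩ := hd'
    refine ⟨i, hqd, fun j hj => ?_⟩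
    have := T.eq_of_mem_sides (by rw [hd]; fin_cases j <;> rfl) hqd hj
    have hfst := congrArg (fun d : T.graph.Dart => d.fst) this
    fin_cases i <;> fin_cases j <;> simp_all

/-- At a leaf the only side consists of all the other qubits. -/
theorem exists_side_of_leaf {v : T.V} (hv : (T.graph.neighborSet v).ncard = 1) :
    ∃ d : T.graph.Dart, d.snd = v ∧ ∃ q₀, T.side d = {q₀}ᶜ := by
  obtain ⟨a, hs⟩ := Set.ncard_eq_one.1 hv
  have ha : T.graph.Adj v a := by
    have : a ∈ T.graph.neighborSet v := by rw [hs]; simp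
    exact this
  refine ⟨⟨(a, v), ha.symm⟩, rfl, T.leaf.symm ⟨v, hv⟩, ?_⟩
  ext q
  rw [Set.mem_compl_iff, Set.mem_singleton_iff]
  constructor
  · rintro h rfl
    exact T.notMem_side_of_leaf_eq (by simp) h
  · intro h
    have hq : (T.leaf q : T.V) ≠ v := by
      intro h'
      apply h
      rw [Equiv.eq_symm_apply]
      exact Subtype.ext h'
    obtain ⟨d, hd, hqd⟩ := T.exists_side_of_ne hq
    have hfst : d.fst ∈ T.graph.neighborSet v := by
      rw [← hd]; exact d.adj.symm
    rw [hs] at hfst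
    have : d = ⟨(a, v), ha.symm⟩ := SimpleGraph.Dart.ext _ _ (Prod.ext hfst hd)
    rwa [← this]

theorem exists_isBalanced [Fintype Q] (hQ : 3 ≤ Fintype.card Q) :
    ∃ d : T.graph.Dart, IsBalanced (T.side d) := by
  by_contra hcon
  push Not at hcon
  have hcompl : ∀ A : Set Q, A.ncard + Aᶜ.ncard = Fintype.card Q := by
    intro A
    rw [Set.ncard_add_ncard_compl, Nat.card_eq_fintype_card]
  -- An edge that is not balanced has a side with less than a third of the qubits. At the vertex
  -- obtained, the one or three incoming sides are then too small to cover the qubits.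
  obtain ⟨v, hv⟩ := T.exists_vertex_of_orientation (fun A => 3 * A.ncard < Fintype.card Q) (by
    intro d
    by_contra h
    push Not at h
    apply hcon d
    have h1 : (Fintype.card Q : ℝ) ≤ 3 * (T.side d).ncard := by exact_mod_cast h.1
    have h2 : (Fintype.card Q : ℝ) ≤ 3 * (T.side d)ᶜ.ncard := by exact_mod_cast h.2
    have h3 : ((T.side d).ncard : ℝ) + (T.side d)ᶜ.ncard = Fintype.card Q := by
      exact_mod_cast hcompl (T.side d)
    refine ⟨⟨?_, ?_⟩, ?_, ?_⟩ <;> linarith)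
  rcases T.degree_eq v with h1 | h3
  · obtain ⟨d, hd, q₀, hq⟩ := T.exists_side_of_leaf h1
    have := hv d hd
    have h2 := hcompl {q₀}
    rw [hq] at this
    rw [Set.ncard_singleton] at h2
    omega
  · obtain ⟨d, hd, hq⟩ := T.exists_three_sides h3
    have h0 := hv _ (hd 0)
    have h1 := hv _ (hd 1)
    have h2 := hv _ (hd 2)
    have hun : (Set.univ : Set Q) = T.side (d 0) ∪ T.side (d 1) ∪ T.side (d 2) := by
      ext q
      obtain ⟨i, hi, -⟩ := hq q
      fin_cases i <;> simp_all
    have h4 := Set.ncard_union_le (T.side (d 0) ∪ T.side (d 1)) (T.side (d 2))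
    have h5 := Set.ncard_union_le (T.side (d 0)) (T.side (d 1))
    rw [← hun, Set.ncard_univ, Nat.card_eq_fintype_card] at h4
    omega

end SubcubicTree

/-! ### Tree tensor networks -/

namespace TreeTensorNetwork

variable {Q : Type*} {T : SubcubicTree Q}

/-- The edges strictly on the near side of the edge underlying `d`. -/
def IsNear (d : T.graph.Dart) (e : T.graph.edgeSet) : Prop :=
  (e : Sym2 T.V) ≠ d.edge ∧
    ∀ w ∈ (e : Sym2 T.V), (T.graph.deleteEdges {d.edge}).Reachable d.fst w

theorem isNear_of_mem {d : T.graph.Dart} {e : T.graph.edgeSet} {w : T.V}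
    (hw : w ∈ (e : Sym2 T.V)) (hS : (T.graph.deleteEdges {d.edge}).Reachable d.fst w)
    (he : (e : Sym2 T.V) ≠ d.edge) : IsNear d e := by
  refine ⟨he, fun w' hw' => ?_⟩
  by_cases hww : w' = w
  · rwa [hww]
  · have h1 : (e : Sym2 T.V) = s(w, w') := (Sym2.mem_and_mem_iff (Ne.symm hww)).1 ⟨hw, hw'⟩
    refine hS.trans (SimpleGraph.Adj.reachable ?_)
    rw [SimpleGraph.deleteEdges_adj, ← h1]
    refine ⟨?_, he⟩
    have := e.2
    rw [h1] at this
    exact this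

theorem not_isNear_of_mem {d : T.graph.Dart} {e : T.graph.edgeSet} {w : T.V}
    (hw : w ∈ (e : Sym2 T.V)) (hS : ¬ (T.graph.deleteEdges {d.edge}).Reachable d.fst w) :
    ¬ IsNear d e := fun h => hS (h.2 w hw)

variable [Fintype Q] (N : TreeTensorNetwork T)

open scoped Classical in
/-- The amplitude matrix of a tree tensor network state factors through the bond space of any
tree edge. -/
theorem exists_factorization (d : T.graph.Dart) :
    ∃ (F : (T.side d → ZMod 2) → Fin (N.bond ⟨d.edge, d.edge_mem⟩) → ℂ)
      (H : Fin (N.bond ⟨d.edge, d.edge_mem⟩) → ({q // q ∉ T.side d} → ZMod 2) → ℂ),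
      ∀ y z, amplitudeMatrix N.state (T.side d) y z = ∑ k, F y k * H k z := by
  set e₀ : T.graph.edgeSet := ⟨d.edge, d.edge_mem⟩ with he₀
  let p : T.graph.edgeSet → Prop := IsNear d
  have hp₀ : ¬ p e₀ := fun h => h.1 rfl
  let E := Equiv.piEquivPiSubtypeProd p (fun e => Fin (N.bond e))
  let S : T.V → Prop := fun v => (T.graph.deleteEdges {d.edge}).Reachable d.fst v
  let F' : (T.side d → ZMod 2) → (∀ e : {e // ¬ p e}, Fin (N.bond e)) → ℂ := fun y b₂ =>
    ∑ b₁ : ∀ e : {e // p e}, Fin (N.bond e),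
      (∏ q : T.side d, N.leafTensor q (fun e => E.symm (b₁, b₂) e.1) (y q)) *
        ∏ v : {v : {v : T.V // (T.graph.neighborSet v).ncard = 3} // S v},
          N.innerTensor v (fun e => E.symm (b₁, b₂) e.1)
  let H' : (∀ e : {e // ¬ p e}, Fin (N.bond e)) → ({q // q ∉ T.side d} → ZMod 2) → ℂ :=
    fun b₂ z =>
      (∏ q : {q // q ∉ T.side d}, N.leafTensor q
        (fun e => b₂ ⟨e.1, not_isNear_of_mem e.2 q.2⟩) (z q)) *
        ∏ v : {v : {v : T.V // (T.graph.neighborSet v).ncard = 3} // ¬ S v},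
          N.innerTensor v (fun e => b₂ ⟨e.1, not_isNear_of_mem e.2 v.2⟩)
  -- The near tensors see the far indices only through `e₀`, since any other edge at a near vertex
  -- is itself near.
  have hF' : ∀ y b₂ b₂', b₂ ⟨e₀, hp₀⟩ = b₂' ⟨e₀, hp₀⟩ → F' y b₂ = F' y b₂' := by
    intro y b₂ b₂' hb
    have hE : ∀ (b₁ : ∀ e : {e // p e}, Fin (N.bond e)) (w : T.V) (_ : S w) (e : T.graph.edgeSet),
        w ∈ (e : Sym2 T.V) → E.symm (b₁, b₂) e = E.symm (b₁, b₂') e := by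
      intro b₁ w hw e hwe
      simp only [E, Equiv.piEquivPiSubtypeProd_symm_apply]
      by_cases he : p e
      · simp [he]
      · simp only [he, dif_neg, not_false_eq_true]
        have : e = e₀ := by
          by_contra hne
          exact he (isNear_of_mem hwe hw fun h => hne (Subtype.ext h))
        subst this
        exact hb
    refine Finset.sum_congr rfl fun b₁ _ => ?_
    congr 1
    · refine Finset.prod_congr rfl fun q _ => ?_
      congr 1
      funext e
      exact hE b₁ _ q.2 e.1 e.2
    · refine Finset.prod_congr rfl fun v _ => ?_
      congr 1
      funext e
      exact hE b₁ _ v.2 e.1 e.2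
  -- If some far bond has dimension `0`, no configuration extends `k`. The default `0` is harmless
  -- then, because the matching sum in the other factor is empty.
  refine ⟨fun y k => if h : ∃ b₂ : ∀ e : {e // ¬ p e}, Fin (N.bond e), b₂ ⟨e₀, hp₀⟩ = k
      then F' y h.choose else 0,
    fun k z => ∑ b₂ ∈ Finset.univ.filter
      (fun b₂ : ∀ e : {e // ¬ p e}, Fin (N.bond e) => b₂ ⟨e₀, hp₀⟩ = k), H' b₂ z, ?_⟩
  intro y z
  have hFk : ∀ b₂ : ∀ e : {e // ¬ p e}, Fin (N.bond e),
      (if h : ∃ b₂' : ∀ e : {e // ¬ p e}, Fin (N.bond e), b₂' ⟨e₀, hp₀⟩ = b₂ ⟨e₀, hp₀⟩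
        then F' y h.choose else 0) = F' y b₂ := by
    intro b₂
    have h : ∃ b₂' : ∀ e : {e // ¬ p e}, Fin (N.bond e), b₂' ⟨e₀, hp₀⟩ = b₂ ⟨e₀, hp₀⟩ := ⟨b₂, rfl⟩
    rw [dif_pos h]
    exact hF' y _ _ h.choose_spec
  have hrhs : ∀ k : Fin (N.bond e₀),
      (if h : ∃ b₂ : ∀ e : {e // ¬ p e}, Fin (N.bond e), b₂ ⟨e₀, hp₀⟩ = k
        then F' y h.choose else 0) *
      (∑ b₂ ∈ Finset.univ.filter
        (fun b₂ : ∀ e : {e // ¬ p e}, Fin (N.bond e) => b₂ ⟨e₀, hp₀⟩ = k), H' b₂ z) =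
      ∑ b₂ ∈ Finset.univ.filter
        (fun b₂ : ∀ e : {e // ¬ p e}, Fin (N.bond e) => b₂ ⟨e₀, hp₀⟩ = k), F' y b₂ * H' b₂ z := by
    intro k
    rw [Finset.mul_sum]
    refine Finset.sum_congr rfl fun b₂ hb => ?_
    obtain rfl := (Finset.mem_filter.1 hb).2
    rw [hFk]
  rw [Finset.sum_congr rfl fun k _ => hrhs k, Finset.sum_fiberwise, amplitudeMatrix_apply]
  unfold state
  rw [← E.symm.sum_comp, Fintype.sum_prod_type_right]
  refine Finset.sum_congr rfl fun b₂ _ => ?_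
  rw [Finset.sum_mul]
  refine Finset.sum_congr rfl fun b₁ _ => ?_
  rw [← Fintype.prod_subtype_mul_prod_subtype (fun q => q ∈ T.side d),
    ← Fintype.prod_subtype_mul_prod_subtype
      (fun v : {v : T.V // (T.graph.neighborSet v).ncard = 3} => S v), mul_mul_mul_comm]
  have hE : ∀ (w : T.V) (hw : ¬ S w) (e : T.graph.edgeSet) (he : w ∈ (e : Sym2 T.V)),
      E.symm (b₁, b₂) e = b₂ ⟨e, not_isNear_of_mem he hw⟩ := by
    intro w hw e he
    have : ¬ p e := not_isNear_of_mem he hw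
    simp only [E, Equiv.piEquivPiSubtypeProd_symm_apply, this, dif_neg, not_false_eq_true]
  congr 1
  · congr 1
    refine Finset.prod_congr rfl fun q _ => ?_
    have : glue (T.side d) y z q = y q := by simp [glue]
    rw [this]
  · congr 1
    · refine Finset.prod_congr rfl fun q _ => ?_
      have : glue (T.side d) y z q = z q := by
        have := q.2
        simp only [glue, this, dif_neg, not_false_eq_true]
      rw [this]
      congr 1
      funext e
      exact hE _ q.2 e.1 e.2
    · refine Finset.prod_congr rfl fun v _ => ?_
      congr 1
      funext e
      exact hE _ v.2 e.1 e.2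

theorem bond_pos (h : N.state ≠ 0) (e : T.graph.edgeSet) : 0 < N.bond e := by
  classical
  by_contra h0
  apply h
  funext x
  have : IsEmpty ((e : T.graph.edgeSet) → Fin (N.bond e)) := by
    refine ⟨fun b => ?_⟩
    have := (b e).pos
    exact h0 this
  unfold state
  rw [Finset.univ_eq_empty, Finset.sum_empty]
  rfl

open scoped Classical in
theorem bond_le_numEntries (h : N.state ≠ 0) (e : T.graph.edgeSet) : N.bond e ≤ N.numEntries := by
  have key : ∀ v : T.V, v ∈ (e : Sym2 T.V) →
      N.bond e ≤ Fintype.card ((e : T.Incident v) → Fin (N.bond e.1)) := by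
    intro v hv
    rw [Fintype.card_pi]
    simp only [Fintype.card_fin]
    exact Finset.single_le_prod' (f := fun e : T.Incident v => N.bond e.1)
      (fun i _ => N.bond_pos h i.1) (Finset.mem_univ (⟨e, hv⟩ : T.Incident v))
  have hsum : ∀ {ι : Type _} [Fintype ι] (g : ι → ℕ) (i : ι), g i ≤ ∑ j, g j := fun g i =>
    Finset.single_le_sum (fun _ _ => Nat.zero_le _) (Finset.mem_univ i)
  have hsum' : ∀ {ι : Type} [Fintype ι] (g : ι → ℕ) (i : ι), g i ≤ ∑ j, g j := fun g i =>
    Finset.single_le_sum (fun _ _ => Nat.zero_le _) (Finset.mem_univ i)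
  obtain ⟨v, hv⟩ : ∃ v, v ∈ (e : Sym2 T.V) := ⟨_, Sym2.out_fst_mem _⟩
  unfold numEntries
  rcases T.degree_eq v with h1 | h3
  · obtain ⟨q, hq⟩ : ∃ q, (T.leaf q : T.V) = v := ⟨T.leaf.symm ⟨v, h1⟩, by simp⟩
    have h4 := key (T.leaf q) (hq ▸ hv)
    refine le_trans ?_ (Nat.le_add_right _ _)
    refine le_trans ?_ (hsum _ q)
    rw [Fintype.card_prod]
    exact h4.trans (Nat.le_mul_of_pos_right _ Fintype.card_pos)
  · refine le_trans ?_ (Nat.le_add_left _ _)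
    refine le_trans ?_ (hsum' _ ⟨v, h3⟩)
    exact key v hv

end TreeTensorNetwork

/-! ### Caterpillars -/

section Caterpillar

/-- The parent of a vertex of the caterpillar on `0, 1, 2, …` with spine `1, 3, 5, …`. -/
def caterpillarParent (k : ℕ) : ℕ := if k % 2 = 0 then k - 1 else k - 2

theorem caterpillarParent_spec (k : ℕ) : (k % 2 = 0 ∧ caterpillarParent k = k - 1) ∨
    (k % 2 = 1 ∧ caterpillarParent k = k - 2) := by
  unfold caterpillarParent
  split_ifs <;> omega

/-- The caterpillar with `m + 3` leaves and `m + 1` inner vertices. -/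
def caterpillar (m : ℕ) : SimpleGraph (Fin (2 * m + 4)) where
  Adj u v := (0 < v.1 ∧ u.1 = caterpillarParent v.1) ∨ (0 < u.1 ∧ v.1 = caterpillarParent u.1)
  symm := ⟨fun _ _ h => h.symm⟩
  loopless := ⟨fun v h => by have := caterpillarParent_spec v.1; omega⟩

theorem caterpillar_adj {m : ℕ} {u v : Fin (2 * m + 4)} : (caterpillar m).Adj u v ↔
    (0 < v.1 ∧ u.1 = caterpillarParent v.1) ∨ (0 < u.1 ∧ v.1 = caterpillarParent u.1) := Iff.rfl

theorem caterpillar_connected (m : ℕ) : (caterpillar m).Connected := by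
  have h : ∀ k (hk : k < 2 * m + 4), (caterpillar m).Reachable 0 ⟨k, hk⟩ := by
    intro k
    induction k using Nat.strong_induction_on with
    | _ k ih =>
      intro hk
      rcases Nat.eq_zero_or_pos k with rfl | h0
      · exact SimpleGraph.Reachable.refl _
      · have hp := caterpillarParent_spec k
        refine (ih (caterpillarParent k) (by omega) (by omega)).trans (SimpleGraph.Adj.reachable ?_)
        rw [caterpillar_adj]
        exact Or.inl ⟨h0, rfl⟩
  exact ⟨fun u v => (h u.1 u.2).symm.trans (h v.1 v.2)⟩

/-- Sending each vertex other than `0` to the edge to its parent enumerates the edges, one fewer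
than the vertices. -/
theorem caterpillar_isTree (m : ℕ) : (caterpillar m).IsTree := by
  rw [SimpleGraph.isTree_iff_connected_and_card]
  refine ⟨caterpillar_connected m, ?_⟩
  let f : Fin (2 * m + 3) → (caterpillar m).edgeSet := fun k =>
    ⟨s(⟨k.1 + 1, by omega⟩, ⟨caterpillarParent (k.1 + 1), by
      have := caterpillarParent_spec (k.1 + 1); omega⟩), by
      rw [SimpleGraph.mem_edgeSet, caterpillar_adj]
      exact Or.inr ⟨Nat.succ_pos _, rfl⟩⟩
  have hf : Function.Bijective f := by
    constructor
    · intro a b hab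
      have hab := congrArg Subtype.val hab
      simp only [f, Sym2.eq_iff, Fin.mk.injEq] at hab
      have h1 := caterpillarParent_spec (a.1 + 1)
      have h2 := caterpillarParent_spec (b.1 + 1)
      ext
      omega
    · rintro ⟨e, he⟩
      induction e using Sym2.ind with
      | _ u v =>
        rw [SimpleGraph.mem_edgeSet, caterpillar_adj] at he
        rcases he with ⟨h0, h⟩ | ⟨h0, h⟩
        · refine ⟨⟨v.1 - 1, by omega⟩, Subtype.ext ?_⟩
          simp only [f, Sym2.eq_iff, Fin.ext_iff]
          right
          rw [Nat.sub_add_cancel h0]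
          exact ⟨rfl, h.symm⟩
        · refine ⟨⟨u.1 - 1, by omega⟩, Subtype.ext ?_⟩
          simp only [f, Sym2.eq_iff, Fin.ext_iff]
          left
          rw [Nat.sub_add_cancel h0]
          exact ⟨rfl, h.symm⟩
  rw [← Nat.card_eq_of_bijective f hf, Nat.card_fin, Nat.card_fin]

theorem caterpillar_neighborSet_leaf {m : ℕ} {v : Fin (2 * m + 4)}
    (hv : v.1 % 2 = 0 ∨ v.1 = 2 * m + 3) : ((caterpillar m).neighborSet v).ncard = 1 := by
  rw [Set.ncard_eq_one]
  -- Vertex `0` is a leaf attached to `1`: truncated subtraction makes `0` the parent of `1`.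
  refine ⟨⟨if v.1 = 0 then 1 else caterpillarParent v.1, ?_⟩, ?_⟩
  · have := caterpillarParent_spec v.1
    split_ifs <;> omega
  · ext w
    rw [SimpleGraph.mem_neighborSet, caterpillar_adj, Set.mem_singleton_iff, Fin.ext_iff]
    have h1 := caterpillarParent_spec v.1
    have h2 := caterpillarParent_spec w.1
    have h3 := w.2
    dsimp only
    split_ifs <;> omega

theorem caterpillar_neighborSet_inner {m : ℕ} {v : Fin (2 * m + 4)}
    (hv : ¬ (v.1 % 2 = 0 ∨ v.1 = 2 * m + 3)) : ((caterpillar m).neighborSet v).ncard = 3 := by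
  have hv2 := v.2
  have h1 := caterpillarParent_spec v.1
  rw [Set.ncard_eq_three]
  refine ⟨⟨caterpillarParent v.1, by omega⟩, ⟨v.1 + 1, by omega⟩, ⟨v.1 + 2, by omega⟩,
    ?_, ?_, ?_, ?_⟩
  · rw [ne_eq, Fin.mk.injEq]; omega
  · rw [ne_eq, Fin.mk.injEq]; omega
  · rw [ne_eq, Fin.mk.injEq]; omega
  · ext w
    rw [SimpleGraph.mem_neighborSet, caterpillar_adj]
    simp only [Set.mem_insert_iff, Set.mem_singleton_iff, Fin.ext_iff]
    have h2 := caterpillarParent_spec w.1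
    have h3 := w.2
    omega

theorem nonempty_subcubicTree {Q : Type*} [Fintype Q] (hQ : 3 ≤ Fintype.card Q) :
    Nonempty (SubcubicTree Q) := by
  obtain ⟨m, hm⟩ := Nat.exists_eq_add_of_le hQ
  have hleaf : ∀ v, ((caterpillar m).neighborSet v).ncard = 1 ↔
      (v.1 % 2 = 0 ∨ v.1 = 2 * m + 3) := by
    intro v
    refine ⟨fun h => ?_, caterpillar_neighborSet_leaf⟩
    by_contra h'
    rw [caterpillar_neighborSet_inner h'] at h
    omega
  -- The leaves are the `m + 2` even vertices and the far end `2 * m + 3` of the spine.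
  let f : Fin (m + 3) → {v // ((caterpillar m).neighborSet v).ncard = 1} := fun k =>
    ⟨⟨if k.1 < m + 2 then 2 * k.1 else 2 * m + 3, by split_ifs <;> omega⟩, by
      rw [hleaf]; dsimp only; split_ifs <;> omega⟩
  have hf : Function.Bijective f := by
    constructor
    · intro a b hab
      have hab := congrArg (fun v => v.1.1) hab
      simp only [f] at hab
      ext
      split_ifs at hab <;> omega
    · rintro ⟨v, hv⟩
      rw [hleaf] at hv
      have hv2 := v.2
      refine ⟨⟨if v.1 % 2 = 0 then v.1 / 2 else m + 2, by split_ifs <;> omega⟩,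
        Subtype.ext (Fin.ext ?_)⟩
      simp only [f]
      split_ifs <;> omega
  exact ⟨{ V := Fin (2 * m + 4)
           graph := caterpillar m
           isTree := caterpillar_isTree m
           degree_eq := fun v => by
             by_cases h : v.1 % 2 = 0 ∨ v.1 = 2 * m + 3
             · exact Or.inl (caterpillar_neighborSet_leaf h)
             · exact Or.inr (caterpillar_neighborSet_inner h)
           leaf := (Fintype.equivFinOfCardEq (by rw [hm, add_comm])).trans (Equiv.ofBijective f hf) }⟩

end Caterpillar

/-! ### Chains on the square lattice -/

section Lattice

variable {L : ℕ}

theorem squareLattice_adj {u v : Fin (L + 1) × Fin (L + 1)} : (squareLattice L).Adj u v ↔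
    ((u.1.1 + 1 = v.1.1 ∨ v.1.1 + 1 = u.1.1) ∧ u.2 = v.2) ∨
      ((u.2.1 + 1 = v.2.1 ∨ v.2.1 + 1 = u.2.1) ∧ u.1 = v.1) := by
  rw [SimpleGraph.boxProd_adj, SimpleGraph.pathGraph_adj, SimpleGraph.pathGraph_adj]

theorem hAdj (i : Fin (L + 1)) (j : Fin L) :
    (squareLattice L).Adj (i, j.castSucc) (i, j.succ) :=
  squareLattice_adj.2 (Or.inr ⟨Or.inl (by simp), rfl⟩)

theorem vAdj (i : Fin L) (j : Fin (L + 1)) :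
    (squareLattice L).Adj (i.castSucc, j) (i.succ, j) :=
  squareLattice_adj.2 (Or.inl ⟨Or.inl (by simp), rfl⟩)

/-- The edge of row `i` crossing from column `j` to column `j + 1`. -/
def hE (i : Fin (L + 1)) (j : Fin L) : LatticeQubit L := ⟨s((i, j.castSucc), (i, j.succ)), hAdj i j⟩

/-- The edge of column `j` crossing from row `i` to row `i + 1`. -/
def vE (i : Fin L) (j : Fin (L + 1)) : LatticeQubit L := ⟨s((i.castSucc, j), (i.succ, j)), vAdj i j⟩

theorem mem_hE {i : Fin (L + 1)} {j : Fin L} {v : Fin (L + 1) × Fin (L + 1)} :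
    v ∈ (hE i j : Sym2 (Fin (L + 1) × Fin (L + 1))) ↔ v = (i, j.castSucc) ∨ v = (i, j.succ) :=
  Sym2.mem_iff

theorem mem_vE {i : Fin L} {j : Fin (L + 1)} {v : Fin (L + 1) × Fin (L + 1)} :
    v ∈ (vE i j : Sym2 (Fin (L + 1) × Fin (L + 1))) ↔ v = (i.castSucc, j) ∨ v = (i.succ, j) :=
  Sym2.mem_iff

theorem hE_inj {i i' : Fin (L + 1)} {j j' : Fin L} : hE i j = hE i' j' ↔ i = i' ∧ j = j' := by
  constructor
  · intro h
    have h := congrArg Subtype.val h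
    simp only [hE, Sym2.eq_iff, Prod.mk.injEq, Fin.ext_iff, Fin.val_castSucc, Fin.val_succ] at h
    rw [Fin.ext_iff, Fin.ext_iff]
    omega
  · rintro ⟨rfl, rfl⟩; rfl

theorem vE_inj {i i' : Fin L} {j j' : Fin (L + 1)} : vE i j = vE i' j' ↔ i = i' ∧ j = j' := by
  constructor
  · intro h
    have h := congrArg Subtype.val h
    simp only [vE, Sym2.eq_iff, Prod.mk.injEq, Fin.ext_iff, Fin.val_castSucc, Fin.val_succ] at h
    rw [Fin.ext_iff, Fin.ext_iff]
    omega
  · rintro ⟨rfl, rfl⟩; rfl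

theorem hE_ne_vE {i : Fin (L + 1)} {j : Fin L} {i' : Fin L} {j' : Fin (L + 1)} :
    hE i j ≠ vE i' j' := by
  intro h
  have h := congrArg Subtype.val h
  simp only [hE, vE, Sym2.eq_iff, Prod.mk.injEq, Fin.ext_iff, Fin.val_castSucc, Fin.val_succ] at h
  omega

theorem edge_cases (e : LatticeQubit L) : (∃ i j, e = hE i j) ∨ (∃ i j, e = vE i j) := by
  obtain ⟨e, he⟩ := e
  induction e using Sym2.ind with
  | _ u v =>
    obtain ⟨u1, u2⟩ := u
    obtain ⟨v1, v2⟩ := v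
    rw [SimpleGraph.mem_edgeSet, squareLattice_adj] at he
    dsimp only at he
    rcases he with ⟨h | h, h'⟩ | ⟨h | h, h'⟩
    · subst h'
      exact Or.inr ⟨⟨u1.1, by omega⟩, u2, Subtype.ext
        (Sym2.eq_iff.2 (Or.inl ⟨rfl, Prod.ext (Fin.ext h.symm) rfl⟩))⟩
    · subst h'
      exact Or.inr ⟨⟨v1.1, by omega⟩, u2, Subtype.ext
        (Sym2.eq_iff.2 (Or.inr ⟨Prod.ext (Fin.ext h.symm) rfl, rfl⟩))⟩
    · subst h'
      exact Or.inl ⟨u1, ⟨u2.1, by omega⟩, Subtype.ext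
        (Sym2.eq_iff.2 (Or.inl ⟨rfl, Prod.ext rfl (Fin.ext h.symm)⟩))⟩
    · subst h'
      exact Or.inl ⟨u1, ⟨v2.1, by omega⟩, Subtype.ext
        (Sym2.eq_iff.2 (Or.inr ⟨Prod.ext rfl (Fin.ext h.symm), rfl⟩))⟩

/-- The indicator of a vertex, as a `0`-chain. -/
noncomputable def vertexChain (v : Fin (L + 1) × Fin (L + 1)) :
    Fin (L + 1) × Fin (L + 1) → ZMod 2 := Pi.single v 1

theorem bd_single_hE [DecidableEq (LatticeQubit L)] (i : Fin (L + 1)) (j : Fin L) :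
    bd (squareLattice L) (Pi.single (hE i j) 1) =
      vertexChain (i, j.castSucc) + vertexChain (i, j.succ) := by
  exact bd_single (hAdj i j)

theorem bd_single_vE [DecidableEq (LatticeQubit L)] (i : Fin L) (j : Fin (L + 1)) :
    bd (squareLattice L) (Pi.single (vE i j) 1) =
      vertexChain (i.castSucc, j) + vertexChain (i.succ, j) := by
  exact bd_single (vAdj i j)

open scoped Classical in
/-- The path along row `i` from column `0` to column `k`. -/
noncomputable def rowPrefix (i : Fin (L + 1)) (k : ℕ) : LatticeQubit L → ZMod 2 :=
  fun e => if ∃ j : Fin L, j.1 < k ∧ e = hE i j then 1 else 0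

open scoped Classical in
/-- The path along column `j` from row `0` to row `k`. -/
noncomputable def colPrefix (j : Fin (L + 1)) (k : ℕ) : LatticeQubit L → ZMod 2 :=
  fun e => if ∃ i : Fin L, i.1 < k ∧ e = vE i j then 1 else 0

theorem rowPrefix_hE (i i' : Fin (L + 1)) (k : ℕ) (j : Fin L) :
    rowPrefix i k (hE i' j) = if i' = i ∧ j.1 < k then 1 else 0 := by
  unfold rowPrefix
  congr 1
  rw [eq_iff_iff]
  constructor
  · rintro ⟨j', hj', h⟩
    obtain ⟨rfl, rfl⟩ := hE_inj.1 h
    exact ⟨rfl, hj'⟩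
  · rintro ⟨rfl, h⟩
    exact ⟨j, h, rfl⟩

theorem rowPrefix_vE (i : Fin (L + 1)) (k : ℕ) (i' : Fin L) (j : Fin (L + 1)) :
    rowPrefix i k (vE i' j) = 0 :=
  if_neg fun ⟨_, _, h⟩ => hE_ne_vE h.symm

theorem colPrefix_hE (j : Fin (L + 1)) (k : ℕ) (i : Fin (L + 1)) (j' : Fin L) :
    colPrefix j k (hE i j') = 0 :=
  if_neg fun ⟨_, _, h⟩ => hE_ne_vE h

theorem colPrefix_vE_of_ne {j j' : Fin (L + 1)} (h : j' ≠ j) (k : ℕ) (i : Fin L) :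
    colPrefix j k (vE i j') = 0 :=
  if_neg fun ⟨_, _, h'⟩ => h (vE_inj.1 h').2

theorem bd_rowPrefix (i : Fin (L + 1)) (k : Fin (L + 1)) :
    bd (squareLattice L) (rowPrefix i k) = vertexChain (i, 0) + vertexChain (i, k) := by
  classical
  obtain ⟨k, hk⟩ := k
  induction k with
  | zero =>
    have : rowPrefix i 0 = 0 := by funext e; simp [rowPrefix]
    dsimp only
    rw [this, map_zero]
    exact (add_self_chain _).symm
  | succ k ih =>
    have hk' : k < L := by omega
    have : rowPrefix i (k + 1) = rowPrefix i k + Pi.single (hE i ⟨k, hk'⟩) 1 := by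
      funext e
      rcases edge_cases e with ⟨i', j, rfl⟩ | ⟨i', j, rfl⟩
      · rw [Pi.add_apply, rowPrefix_hE, rowPrefix_hE, Pi.single_apply]
        simp only [hE_inj, Fin.ext_iff]
        split_ifs <;> first | rfl | omega
      · rw [Pi.add_apply, rowPrefix_vE, rowPrefix_vE, Pi.single_apply, if_neg hE_ne_vE.symm,
          add_zero]
    have h1 := ih (by omega)
    dsimp only at h1 ⊢
    rw [this, map_add, h1, bd_single_hE, add_assoc, ← add_assoc (vertexChain (i, ⟨k, _⟩))]
    congr 1
    exact (congrArg (· + _) (add_self_chain _)).trans (zero_add _)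

theorem bd_colPrefix (j : Fin (L + 1)) (k : Fin (L + 1)) :
    bd (squareLattice L) (colPrefix j k) = vertexChain (0, j) + vertexChain (k, j) := by
  classical
  obtain ⟨k, hk⟩ := k
  induction k with
  | zero =>
    have : colPrefix j 0 = 0 := by funext e; simp [colPrefix]
    dsimp only
    rw [this, map_zero]
    exact (add_self_chain _).symm
  | succ k ih =>
    have hk' : k < L := by omega
    have : colPrefix j (k + 1) = colPrefix j k + Pi.single (vE ⟨k, hk'⟩ j) 1 := by
      funext e
      rcases edge_cases e with ⟨i', j', rfl⟩ | ⟨i', j', rfl⟩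
      · rw [Pi.add_apply, colPrefix_hE, colPrefix_hE, Pi.single_apply, if_neg hE_ne_vE,
          add_zero]
      · by_cases hj : j' = j
        · subst hj
          have hcol : ∀ k, colPrefix j' k (vE i' j') = if i'.1 < k then 1 else 0 := by
            intro k
            unfold colPrefix
            congr 1
            rw [eq_iff_iff]
            constructor
            · rintro ⟨i, hi, h⟩
              obtain ⟨rfl, -⟩ := vE_inj.1 h
              exact hi
            · exact fun h => ⟨i', h, rfl⟩
          rw [Pi.add_apply, hcol, hcol, Pi.single_apply]
          simp only [vE_inj, Fin.ext_iff, and_true]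
          split_ifs <;> first | rfl | omega
        · rw [Pi.add_apply, colPrefix_vE_of_ne hj, colPrefix_vE_of_ne hj, Pi.single_apply,
            if_neg (fun h => hj (vE_inj.1 h).2), add_zero]
    have h1 := ih (by omega)
    dsimp only at h1 ⊢
    rw [this, map_add, h1, bd_single_vE, add_assoc, ← add_assoc (vertexChain (⟨k, _⟩, j))]
    congr 1
    exact (congrArg (· + _) (add_self_chain _)).trans (zero_add _)

/-- The boundary at a vertex in the interior of a row, for chains avoiding the column. -/
theorem bd_apply_row {w : LatticeQubit L → ZMod 2} (r : Fin (L + 1)) {j j' : Fin L}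
    (hj : j.1 + 1 = j'.1) (hw : ∀ i, w (vE i j.succ) = 0) :
    bd (squareLattice L) w (r, j.succ) = w (hE r j) + w (hE r j') := by
  classical
  have hne : hE r j ≠ hE r j' := by
    intro h
    have := (hE_inj.1 h).2
    rw [this] at hj
    omega
  have hjj : j'.castSucc = j.succ := by ext; simp [hj]
  rw [← Finset.sum_pair hne]
  apply bd_apply_eq_sum
  · intro e he
    rw [Finset.mem_insert, Finset.mem_singleton] at he
    rcases he with rfl | rfl
    · exact mem_hE.2 (Or.inr rfl)
    · exact mem_hE.2 (Or.inl (by rw [hjj]))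
  · intro e he hne
    rcases edge_cases e with ⟨i, k, rfl⟩ | ⟨i, k, rfl⟩
    · exfalso
      apply hne
      rw [Finset.mem_insert, Finset.mem_singleton, hE_inj, hE_inj]
      have := mem_hE.1 he
      simp only [Prod.mk.injEq, Fin.ext_iff, Fin.val_castSucc, Fin.val_succ] at this ⊢
      omega
    · have : k = j.succ := by
        rcases mem_vE.1 he with h | h <;> exact (congrArg Prod.snd h).symm
      rw [this]
      exact hw i

/-- The sum of a `0`-chain over the vertices in the columns `0, …, j`. -/
noncomputable def leftSum (j : Fin L) :
    (Fin (L + 1) × Fin (L + 1) → ZMod 2) →ₗ[ZMod 2] ZMod 2 where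
  toFun f := ∑ v ∈ Finset.univ.filter (fun v : Fin (L + 1) × Fin (L + 1) => v.2.1 ≤ j.1), f v
  map_add' f g := by simp [Finset.sum_add_distrib]
  map_smul' c f := by simp [Finset.mul_sum]

theorem leftSum_vertexChain (j : Fin L) (v : Fin (L + 1) × Fin (L + 1)) :
    leftSum j (vertexChain v) = if v.2.1 ≤ j.1 then 1 else 0 := by
  classical
  change ∑ v' ∈ Finset.univ.filter (fun v : Fin (L + 1) × Fin (L + 1) => v.2.1 ≤ j.1),
    (Pi.single v 1 : Fin (L + 1) × Fin (L + 1) → ZMod 2) v' = _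
  simp only [Pi.single_apply, Finset.sum_ite_eq', Finset.mem_filter, Finset.mem_univ, true_and]

/-- The edges between the columns `j` and `j + 1` form a cut. -/
theorem leftSum_bd (j : Fin L) (w : LatticeQubit L → ZMod 2) :
    leftSum j (bd (squareLattice L) w) = ∑ i, w (hE i j) := by
  classical
  let f : (LatticeQubit L → ZMod 2) →ₗ[ZMod 2] ZMod 2 :=
    { toFun := fun w => ∑ i, w (hE i j)
      map_add' := fun x y => by simp [Finset.sum_add_distrib]
      map_smul' := fun c x => by simp [Finset.mul_sum] }
  -- By linearity a single edge suffices: one crossing band `j` has exactly one endpoint in the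
  -- columns up to `j`, any other edge has none or two.
  suffices h : (leftSum j).comp (bd (squareLattice L)) = f from LinearMap.congr_fun h w
  refine LinearMap.pi_ext fun e c => ?_
  have hc : (Pi.single e c : LatticeQubit L → ZMod 2) = c • Pi.single e 1 := by
    rw [← Pi.single_smul, smul_eq_mul, mul_one]
  rw [hc, map_smul, map_smul]
  congr 1
  rw [LinearMap.comp_apply]
  change _ = ∑ i, (Pi.single e 1 : LatticeQubit L → ZMod 2) (hE i j)
  rcases edge_cases e with ⟨i, k, rfl⟩ | ⟨i, k, rfl⟩
  · rw [bd_single_hE, map_add, leftSum_vertexChain, leftSum_vertexChain]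
    simp only [Pi.single_apply, hE_inj, Fin.val_castSucc, Fin.val_succ]
    by_cases hjk : j = k
    · subst hjk
      simp
    · have hjk' : j.1 ≠ k.1 := fun h => hjk (Fin.ext h)
      simp only [hjk, and_false, if_false, Finset.sum_const_zero]
      split_ifs <;> first | rfl | omega
  · rw [bd_single_vE, map_add, leftSum_vertexChain, leftSum_vertexChain]
    simp only [Pi.single_apply, hE_ne_vE, if_false, Finset.sum_const_zero]
    exact CharTwo.add_self_eq_zero _

end Lattice

/-! ### Lower bounds for the connectivity of edge sets of the lattice -/

section LatticeConn

variable {L : ℕ}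

/-- The cycle is the rectangle formed by rows `i` and `K` and the two outer columns, so it has no
vertical edge at an interior column. -/
theorem exists_rowCycle (i K : Fin (L + 1)) : ∃ z ∈ cycles (squareLattice L),
    (∀ r j, z (hE r j) = (if r = i then 1 else 0) + (if r = K then 1 else 0)) ∧
    ∀ r x, x ≠ 0 → x ≠ Fin.last L → z (vE r x) = 0 := by
  refine ⟨rowPrefix i (Fin.last L) + rowPrefix K (Fin.last L) + (colPrefix 0 i + colPrefix 0 K) +
    (colPrefix (Fin.last L) i + colPrefix (Fin.last L) K), ?_, ?_, ?_⟩
  · rw [mem_cycles]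
    simp only [map_add, bd_rowPrefix, bd_colPrefix]
    funext v
    simp only [Pi.add_apply, Pi.zero_apply]
    grind
  · intro r j
    simp only [Pi.add_apply, rowPrefix_hE, colPrefix_hE, Fin.val_last, j.2, and_true, add_zero]
  · intro r x h0 h1
    simp only [Pi.add_apply, rowPrefix_vE, colPrefix_vE_of_ne h0, colPrefix_vE_of_ne h1, add_zero]

/-- The cycle is the rectangle of width one cut out of the band by rows `i` and `i'`. -/
theorem exists_bandCycle (i i' : Fin (L + 1)) (j : Fin L) : ∃ z ∈ cycles (squareLattice L),
    (∀ r k, z (hE r k) = (if r = i ∧ k = j then 1 else 0) + (if r = i' ∧ k = j then 1 else 0)) ∧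
    ∀ r x, x ≠ j.castSucc → x ≠ j.succ → z (vE r x) = 0 := by
  classical
  refine ⟨Pi.single (hE i j) 1 + Pi.single (hE i' j) 1 +
    (colPrefix j.castSucc i + colPrefix j.castSucc i') +
    (colPrefix j.succ i + colPrefix j.succ i'), ?_, ?_, ?_⟩
  · rw [mem_cycles]
    simp only [map_add, bd_single_hE, bd_colPrefix]
    funext v
    simp only [Pi.add_apply, Pi.zero_apply]
    grind
  · intro r k
    simp only [Pi.add_apply, Pi.single_apply, hE_inj, colPrefix_hE, add_zero]
  · intro r x h0 h1
    simp only [Pi.add_apply, Pi.single_apply, hE_ne_vE.symm, if_false, colPrefix_vE_of_ne h0,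
      colPrefix_vE_of_ne h1, add_zero]

/-- Rows with a change of membership in `A`, and bands between two columns with both kinds of
edges away from these changes, contribute independently to the connectivity of `A`. -/
theorem card_add_card_le_conn (hL : 0 < L) (A : Set (LatticeQubit L)) (I : Finset (Fin (L + 1)))
    (J : Finset (Fin L)) (K : Fin (L + 1)) (hK : K ∉ I)
    (hJ : ∀ j ∈ J, ∃ i i', hE i j ∈ A ∧ hE i' j ∉ A)
    (hI : ∀ i ∈ I, ∃ j j' : Fin L, j.1 + 1 = j'.1 ∧ ¬ (hE i j ∈ A ↔ hE i j' ∈ A) ∧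
      j ∉ J ∧ j' ∉ J) : I.card + J.card ≤ conn A := by
  classical
  have : Nonempty (Fin L) := ⟨⟨0, hL⟩⟩
  choose! t t' ht hch htJ htJ' using hI
  choose! b b' hb hb' using hJ
  choose z hz hzh hzv using fun i : Fin (L + 1) => exists_rowCycle i K
  choose w hw hwh hwv using fun j : Fin L => exists_bandCycle (b j) (b' j) j
  rw [← Fintype.card_coe I, ← Fintype.card_coe J]
  have hcol0 : ∀ i ∈ I, (t i).succ ≠ 0 := fun i _ => Fin.succ_ne_zero _
  have hcol1 : ∀ i ∈ I, (t i).succ ≠ Fin.last L := by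
    intro i hi h
    have := ht i hi
    rw [Fin.ext_iff, Fin.val_succ, Fin.val_last] at h
    omega
  -- A row cycle is tested at the interior vertex where its row changes membership in `A`, so
  -- exactly one of the two edges there survives restriction. A band cycle is tested by the cut at
  -- its band, which sees only its edge in `A`. The changes lie away from `J`, so vertex tests do
  -- not see band cycles.
  refine le_conn_of_dual A (fun i : I => z i) (fun j : J => w j) (fun i => hz i) (fun j => hw j)
    (fun i => LinearMap.proj (i.1, (t i).succ)) (fun j => leftSum j.1) ?_ ?_ ?_
  · rintro ⟨i, hi⟩ ⟨i', hi'⟩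
    rw [LinearMap.proj_apply, bd_apply_row i (ht i hi)]
    · have hiK : i ≠ K := fun h => hK (h ▸ hi)
      have hval : ∀ j, z i' (hE i j) = if i = i' then 1 else 0 := by
        intro j; rw [hzh, if_neg hiK, add_zero]
      simp only [Subtype.mk.injEq]
      have hch := hch i hi
      by_cases h1 : hE i (t i) ∈ A <;> by_cases h2 : hE i (t' i) ∈ A <;>
        simp [restr, h1, h2, hval] at hch ⊢
    · intro r
      have := hzv i' r _ (hcol0 i hi) (hcol1 i hi)
      by_cases h : vE r (t i).succ ∈ A <;> simp [restr, h, this]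
  · rintro ⟨i, hi⟩ ⟨j, hj⟩
    have h1 : t i ≠ j := fun h => htJ i hi (h ▸ hj)
    have h2 : t' i ≠ j := fun h => htJ' i hi (h ▸ hj)
    rw [LinearMap.proj_apply, bd_apply_row i (ht i hi)]
    · have h3 : w j (hE i (t i)) = 0 := by rw [hwh]; simp [h1]
      have h4 : w j (hE i (t' i)) = 0 := by rw [hwh]; simp [h2]
      simp [restr, h3, h4]
    · intro r
      have h5 : (t i).succ ≠ j.castSucc := by
        intro h
        apply h2
        have := ht i hi
        rw [Fin.ext_iff, Fin.val_succ, Fin.val_castSucc] at h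
        ext
        omega
      have := hwv j r _ h5 (fun h => h1 (Fin.succ_injective _ h))
      by_cases h : vE r (t i).succ ∈ A <;> simp [restr, h, this]
  · rintro ⟨j, hj⟩ ⟨j', hj'⟩
    rw [leftSum_bd]
    simp only [Subtype.mk.injEq]
    by_cases hjj : j = j'
    · subst hjj
      have h1 := hb j hj
      have h2 := hb' j hj
      have h3 : ∀ r, restr A (w j) (hE r j) = if r = b j then 1 else 0 := by
        intro r
        by_cases hr : hE r j ∈ A
        · have hr' : r ≠ b' j := by rintro rfl; exact h2 hr
          rw [restr_apply_mem _ hr, hwh]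
          simp [hr']
        · have hr' : r ≠ b j := by rintro rfl; exact hr h1
          rw [restr_apply_notMem _ hr]
          simp [hr']
      simp [h3]
    · rw [if_neg hjj]
      refine Finset.sum_eq_zero fun r _ => ?_
      have : w j' (hE r j) = 0 := by rw [hwh]; simp [hjj]
      simp [restr, this]

/-- A band free of `C` separates the contributions of the rows on its two sides, provided that
the complement of `C` is connected. -/
theorem card_left_add_card_right_le_conn (C : Set (LatticeQubit L)) (K : Fin (L + 1)) (c : Fin L)
    (hK : ∀ j, hE K j ∉ C) (hc : ∀ i, hE i c ∉ C)
    (hconn : ∀ e ∉ C, ∀ v ∈ (e : Sym2 (Fin (L + 1) × Fin (L + 1))),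
      ∃ y ∈ chainsIn Cᶜ, bd (squareLattice L) y = vertexChain v + vertexChain (K, 0))
    (R S : Finset (Fin (L + 1))) (hR : ∀ i ∈ R, ∃ j, j < c ∧ hE i j ∈ C)
    (hS : ∀ i ∈ S, ∃ j, c < j ∧ hE i j ∈ C) : R.card + S.card ≤ conn C := by
  classical
  -- The edge of `C` in row `i` nearest to the free band on the left is followed by an edge outside
  -- `C`.
  have hR' : ∀ i ∈ R, ∃ j j' : Fin L, j.1 + 1 = j'.1 ∧ j < c ∧ hE i j ∈ C ∧ hE i j' ∉ C := by
    intro i hi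
    obtain ⟨j, hj, hmax⟩ := Finset.exists_max_image
      (Finset.univ.filter fun j : Fin L => j < c ∧ hE i j ∈ C) id (by
        obtain ⟨j, hj⟩ := hR i hi
        exact ⟨j, Finset.mem_filter.2 ⟨Finset.mem_univ _, hj⟩⟩)
    obtain ⟨-, hjc, hjC⟩ := Finset.mem_filter.1 hj
    have hjc' : j.1 < c.1 := hjc
    refine ⟨j, ⟨j.1 + 1, by omega⟩, rfl, hjc, hjC, fun h => ?_⟩
    rcases Nat.lt_or_ge (j.1 + 1) c.1 with h1 | h1
    · have h2 : j.1 + 1 ≤ j.1 := hmax ⟨j.1 + 1, by omega⟩ (Finset.mem_filter.2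
        ⟨Finset.mem_univ _, h1, h⟩)
      omega
    · have : (⟨j.1 + 1, by omega⟩ : Fin L) = c := Fin.ext (by dsimp only; omega)
      rw [this] at h
      exact hc i h
  have hS' : ∀ i ∈ S, ∃ j j' : Fin L, j.1 + 1 = j'.1 ∧ c < j' ∧ hE i j ∉ C ∧ hE i j' ∈ C := by
    intro i hi
    obtain ⟨j, hj, hmin⟩ := Finset.exists_min_image
      (Finset.univ.filter fun j : Fin L => c < j ∧ hE i j ∈ C) id (by
        obtain ⟨j, hj⟩ := hS i hi
        exact ⟨j, Finset.mem_filter.2 ⟨Finset.mem_univ _, hj⟩⟩)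
    obtain ⟨-, hjc, hjC⟩ := Finset.mem_filter.1 hj
    have hjc' : c.1 < j.1 := hjc
    refine ⟨⟨j.1 - 1, by omega⟩, j, by dsimp only; omega, hjc, fun h => ?_, hjC⟩
    rcases Nat.lt_or_ge c.1 (j.1 - 1) with h1 | h1
    · have h2 : j.1 ≤ j.1 - 1 := hmin ⟨j.1 - 1, by omega⟩ (Finset.mem_filter.2
        ⟨Finset.mem_univ _, h1, h⟩)
      omega
    · have : (⟨j.1 - 1, by omega⟩ : Fin L) = c := Fin.ext (by dsimp only; omega)
      rw [this] at h
      exact hc i h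
  have : Nonempty (Fin L) := ⟨c⟩
  choose! t t' ht htc htC htC' using hR'
  choose! u u' hu huc huC huC' using hS'
  choose y hy hby using fun i : Fin (L + 1) =>
    hconn (hE i c) (hc i) (i, c.castSucc) (mem_hE.2 (Or.inl rfl))
  choose y' hy' hby' using fun i : Fin (L + 1) =>
    hconn (hE i c) (hc i) (i, c.succ) (mem_hE.2 (Or.inr rfl))
  have hnot : ∀ {x : LatticeQubit L → ZMod 2} {e}, x ∈ chainsIn Cᶜ → e ∈ C → x e = 0 :=
    fun hx he => hx _ (by simpa using he)
  have hRK : ∀ i ∈ R, i ≠ K := by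
    rintro i hi rfl; exact hK _ (htC _ hi)
  have hSK : ∀ i ∈ S, i ≠ K := by
    rintro i hi rfl; exact hK _ (huC' _ hi)
  -- `f i` follows row `i` left of the band and column `0` to row `K`; `g i` follows row `i` right
  -- of the band, the last column and row `K`. Both are closed by a chain outside `C`, invisible
  -- after restriction to `C`. Row `K` is also outside `C`, so neither family meets the tests of the
  -- other.
  let f : Fin (L + 1) → LatticeQubit L → ZMod 2 := fun i =>
    rowPrefix i c.castSucc + (colPrefix 0 i + colPrefix 0 K) + y i
  let g : Fin (L + 1) → LatticeQubit L → ZMod 2 := fun i =>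
    rowPrefix i (Fin.last L) + rowPrefix i c.succ +
      (colPrefix (Fin.last L) i + colPrefix (Fin.last L) K) + rowPrefix K (Fin.last L) + y' i
  have hf : ∀ i, f i ∈ cycles (squareLattice L) := by
    intro i
    rw [mem_cycles]
    simp only [f, map_add, bd_rowPrefix, bd_colPrefix, hby]
    funext v
    simp only [Pi.add_apply, Pi.zero_apply]
    grind
  have hg : ∀ i, g i ∈ cycles (squareLattice L) := by
    intro i
    rw [mem_cycles]
    simp only [g, map_add, bd_rowPrefix, bd_colPrefix, hby']
    funext v
    simp only [Pi.add_apply, Pi.zero_apply]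
    grind
  have hfv : ∀ i r x, x ≠ 0 → restr C (f i) (vE r x) = 0 := by
    intro i r x hx
    by_cases h : vE r x ∈ C
    · rw [restr_apply_mem _ h]
      simp only [f, Pi.add_apply, rowPrefix_vE, colPrefix_vE_of_ne hx, hnot (hy i) h, add_zero]
    · exact restr_apply_notMem _ h
  have hgv : ∀ i r x, x ≠ Fin.last L → restr C (g i) (vE r x) = 0 := by
    intro i r x hx
    by_cases h : vE r x ∈ C
    · rw [restr_apply_mem _ h]
      simp only [g, Pi.add_apply, rowPrefix_vE, colPrefix_vE_of_ne hx, hnot (hy' i) h, add_zero]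
    · exact restr_apply_notMem _ h
  rw [← Fintype.card_coe R, ← Fintype.card_coe S]
  refine le_conn_of_dual C (fun i : R => f i) (fun i : S => g i) (fun i => hf i) (fun i => hg i)
    (fun i => LinearMap.proj (i.1, (t i).succ)) (fun i => LinearMap.proj (i.1, (u i).succ)) ?_ ?_ ?_
  · rintro ⟨i, hi⟩ ⟨i', hi'⟩
    have h1 : (t i).1 < c.1 := htc i hi
    rw [LinearMap.proj_apply, bd_apply_row i (ht i hi) (fun r => hfv _ _ _ (Fin.succ_ne_zero _)),
      restr_apply_mem _ (htC i hi), restr_apply_notMem _ (htC' i hi)]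
    simp only [f, Pi.add_apply, rowPrefix_hE, colPrefix_hE, hnot (hy i') (htC i hi), add_zero,
      Fin.val_castSucc, h1, and_true, Subtype.mk.injEq]
  · rintro ⟨i, hi⟩ ⟨i', hi'⟩
    have h1 : (t i).1 < c.1 := htc i hi
    rw [LinearMap.proj_apply, bd_apply_row i (ht i hi) (fun r => hgv _ _ _ ?_),
      restr_apply_mem _ (htC i hi), restr_apply_notMem _ (htC' i hi)]
    · have h2 : (t i).1 < c.1 + 1 := by omega
      simp only [g, Pi.add_apply, rowPrefix_hE, colPrefix_hE, hnot (hy' i') (htC i hi), add_zero,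
        Fin.val_succ, Fin.val_last, (t i).2, h2, and_true, hRK i hi, if_false]
      exact CharTwo.add_self_eq_zero _
    · rw [ne_eq, Fin.ext_iff, Fin.val_succ, Fin.val_last]
      omega
  · rintro ⟨i, hi⟩ ⟨i', hi'⟩
    have h1 : c.1 < (u' i).1 := huc i hi
    have h3 := hu i hi
    rw [LinearMap.proj_apply, bd_apply_row i h3 (fun r => hgv _ _ _ ?_),
      restr_apply_notMem _ (huC i hi), restr_apply_mem _ (huC' i hi)]
    · have h2 : ¬ (u' i).1 < c.1 + 1 := by omega
      simp only [g, Pi.add_apply, rowPrefix_hE, colPrefix_hE, hnot (hy' i') (huC' i hi), add_zero,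
        zero_add, Fin.val_succ, Fin.val_last, (u' i).2, h2, and_true, and_false, hSK i hi, if_false,
        Subtype.mk.injEq]
    · rw [ne_eq, Fin.ext_iff, Fin.val_succ, Fin.val_last]
      omega

end LatticeConn

/-! ### Reachability along edges of the lattice, and filling of pockets -/

section Pockets

variable {L : ℕ}

/-- `v` can be reached from `u` along edges in `S`. -/
def EdgeReach (S : Set (LatticeQubit L)) : Fin (L + 1) × Fin (L + 1) →
    Fin (L + 1) × Fin (L + 1) → Prop :=
  Relation.ReflTransGen fun u v => ∃ e ∈ S, u ∈ (e : Sym2 _) ∧ v ∈ (e : Sym2 _)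

theorem EdgeReach.of_mem {S : Set (LatticeQubit L)} {e : LatticeQubit L}
    {u v : Fin (L + 1) × Fin (L + 1)} (he : e ∈ S) (hu : u ∈ (e : Sym2 _))
    (hv : v ∈ (e : Sym2 _)) : EdgeReach S u v :=
  Relation.ReflTransGen.single ⟨e, he, hu, hv⟩

theorem EdgeReach.mono {S S' : Set (LatticeQubit L)} (h : S ⊆ S')
    {u v : Fin (L + 1) × Fin (L + 1)} (huv : EdgeReach S u v) : EdgeReach S' u v :=
  Relation.ReflTransGen.mono (fun _ _ ⟨e, he, h'⟩ => ⟨e, h he, h'⟩) _ _ huv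

theorem EdgeReach.symm {S : Set (LatticeQubit L)} {u v : Fin (L + 1) × Fin (L + 1)}
    (h : EdgeReach S u v) : EdgeReach S v u := by
  induction h with
  | refl => exact Relation.ReflTransGen.refl
  | tail _ h ih =>
    obtain ⟨e, he, h1, h2⟩ := h
    exact (EdgeReach.of_mem he h2 h1).trans ih

theorem edgeReach_univ (u v : Fin (L + 1) × Fin (L + 1)) : EdgeReach Set.univ u v := by
  have h : (squareLattice L).Connected :=
    (SimpleGraph.pathGraph_connected L).boxProd (SimpleGraph.pathGraph_connected L)
  have := (SimpleGraph.reachable_iff_reflTransGen u v).1 (h.preconnected u v)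
  exact Relation.ReflTransGen.mono (fun x y hxy =>
    ⟨⟨s(x, y), hxy⟩, Set.mem_univ _, Sym2.mem_mk_left _ _, Sym2.mem_mk_right _ _⟩) _ _ this

theorem EdgeReach.exists_chain {S : Set (LatticeQubit L)} {u v : Fin (L + 1) × Fin (L + 1)}
    (h : EdgeReach S u v) :
    ∃ y ∈ chainsIn S, bd (squareLattice L) y = vertexChain v + vertexChain u := by
  classical
  induction h with
  | refl => exact ⟨0, Submodule.zero_mem _, by rw [map_zero]; exact (add_self_chain _).symm⟩
  | @tail b c _ h ih =>
    obtain ⟨e, he, hb, hc⟩ := h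
    obtain ⟨y, hy, hby⟩ := ih
    by_cases hbc : b = c
    · subst hbc
      exact ⟨y, hy, hby⟩
    · obtain ⟨e, hadj⟩ := e
      obtain rfl := (Sym2.mem_and_mem_iff hbc).1 ⟨hb, hc⟩
      refine ⟨y + Pi.single ⟨s(b, c), hadj⟩ 1, Submodule.add_mem _ hy ?_, ?_⟩
      · intro e' he'
        rw [Pi.single_apply, if_neg]
        rintro rfl
        exact he' he
      · have h1 : bd (squareLattice L) (Pi.single ⟨s(b, c), hadj⟩ 1) =
            vertexChain b + vertexChain c := bd_single hadj
        rw [map_add, hby, h1]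
        funext w
        simp only [Pi.add_apply]
        grind

theorem edgeReach_row {S : Set (LatticeQubit L)} {K : Fin (L + 1)} (hK : ∀ j, hE K j ∈ S)
    (k : Fin (L + 1)) : EdgeReach S (K, 0) (K, k) := by
  induction k using Fin.induction with
  | zero => exact Relation.ReflTransGen.refl
  | succ j ih =>
    exact ih.trans (EdgeReach.of_mem (hK j) (mem_hE.2 (Or.inl rfl)) (mem_hE.2 (Or.inr rfl)))

/-- All edges outside `C` can be reached from `v₀` outside `C`. -/
def CoConnected (C : Set (LatticeQubit L)) (v₀ : Fin (L + 1) × Fin (L + 1)) : Prop :=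
  ∀ e ∉ C, ∀ v ∈ (e : Sym2 (Fin (L + 1) × Fin (L + 1))), EdgeReach Cᶜ v₀ v

/-- The edges outside `C` that cannot be reached from `v₀` outside `C`. -/
def pocket (C : Set (LatticeQubit L)) (v₀ : Fin (L + 1) × Fin (L + 1)) : Set (LatticeQubit L) :=
  {e | e ∉ C ∧ ∀ v ∈ (e : Sym2 (Fin (L + 1) × Fin (L + 1))), ¬ EdgeReach Cᶜ v₀ v}

variable {C : Set (LatticeQubit L)} {v₀ : Fin (L + 1) × Fin (L + 1)}

theorem edgeReach_of_notMem_pocket {e : LatticeQubit L} (he : e ∉ C) (he' : e ∉ pocket C v₀)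
    {v : Fin (L + 1) × Fin (L + 1)} (hv : v ∈ (e : Sym2 _)) : EdgeReach Cᶜ v₀ v := by
  by_contra h
  refine he' ⟨he, fun w hw hw' => h (hw'.trans (EdgeReach.of_mem he hw hv))⟩

theorem notMem_of_mem_pocket {e e' : LatticeQubit L} (he : e ∉ C) (he' : e ∉ pocket C v₀)
    (h : e' ∈ pocket C v₀) (v : Fin (L + 1) × Fin (L + 1)) (hv : v ∈ (e : Sym2 _)) :
    v ∉ (e' : Sym2 _) :=
  fun hv' => h.2 v hv' (edgeReach_of_notMem_pocket he he' hv)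

/-- The complement of `C` splits into the pocket and a part sharing no vertex with it; dropping the
pocket cannot raise the connectivity. -/
theorem conn_union_pocket_le : conn (C ∪ pocket C v₀) ≤ conn C := by
  rw [← conn_compl, ← conn_compl C]
  refine conn_le_of_disjoint_vertices (Y := pocket C v₀) ?_ ?_
  · ext e
    simp only [Set.mem_compl_iff, Set.mem_union]
    constructor
    · tauto
    · rintro (h | h)
      · tauto
      · exact h.1
  · intro e he e' he' v hv
    rw [Set.mem_compl_iff, Set.mem_union, not_or] at he
    exact notMem_of_mem_pocket he.1 he.2 he' v hv

theorem conn_diff_pocket_le {B : Set (LatticeQubit L)} (hB : Disjoint B C) :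
    conn (B \ pocket C v₀) ≤ conn B := by
  refine conn_le_of_disjoint_vertices (Y := B ∩ pocket C v₀) (Set.sdiff_union_inter _ _).symm ?_
  intro e he e' he' v hv
  exact notMem_of_mem_pocket (Set.disjoint_left.1 hB he.1) he.2 he'.2 v hv

theorem coConnected_union_pocket : CoConnected (C ∪ pocket C v₀) v₀ := by
  intro e he v hv
  rw [Set.mem_union, not_or] at he
  have := edgeReach_of_notMem_pocket he.1 he.2 hv
  clear hv
  induction this with
  | refl => exact Relation.ReflTransGen.refl
  | tail hb h ih =>
    obtain ⟨e', he', h1, h2⟩ := h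
    refine ih.trans (EdgeReach.of_mem (e := e') ?_ h1 h2)
    rw [Set.mem_compl_iff, Set.mem_union, not_or]
    exact ⟨he', fun h => h.2 _ h1 hb⟩

theorem CoConnected.diff_pocket {B : Set (LatticeQubit L)} {w₀ : Fin (L + 1) × Fin (L + 1)}
    (hBC : Disjoint B C) (hB : CoConnected B w₀) : CoConnected (B \ pocket C v₀) w₀ := by
  have hsub : Bᶜ ⊆ (B \ pocket C v₀)ᶜ := Set.compl_subset_compl.2 Set.sdiff_subset
  -- Walk through the lattice from a vertex of the pocket part of `B` towards `w₀`. An edge of `B`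
  -- at such a vertex is again in the pocket, so the walk avoids `B \ pocket C v₀` until it takes an
  -- edge outside `B`, and from there `w₀` is reachable by `hB`.
  have key : ∀ v, EdgeReach Set.univ v w₀ →
      (∃ e ∈ B ∩ pocket C v₀, v ∈ (e : Sym2 _)) → EdgeReach (B \ pocket C v₀)ᶜ v w₀ := by
    intro v hv
    induction hv using Relation.ReflTransGen.head_induction_on with
    | refl => exact fun _ => Relation.ReflTransGen.refl
    | head h _ ih =>
      rintro ⟨e, he, hve⟩
      obtain ⟨e', -, h1, h2⟩ := h
      by_cases hB' : e' ∈ B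
      · by_cases hD : e' ∈ pocket C v₀
        · exact (EdgeReach.of_mem (fun h => h.2 hD) h1 h2).trans (ih ⟨e', ⟨hB', hD⟩, h2⟩)
        · exact absurd hve
            (notMem_of_mem_pocket (Set.disjoint_left.1 hBC hB') hD he.2 _ h1)
      · exact ((hB e' hB' _ h1).mono hsub).symm
  intro e he v hv
  by_cases hB' : e ∈ B
  · have hD : e ∈ pocket C v₀ := by
      by_contra h
      exact he ⟨hB', h⟩
    exact (key v (edgeReach_univ _ _) ⟨e, ⟨hB', hD⟩, hv⟩).symm
  · exact (hB e hB' v hv).mono hsub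

end Pockets

/-! ### Three-colorings of the lattice with classes of small connectivity -/

section Coloring

variable {L : ℕ}

/-- Every color class has connectivity less than `L`, and misses a row. -/
structure IsBad (κ : LatticeQubit L → Fin 3) (K : Fin 3 → Fin (L + 1)) : Prop where
  conn_lt : ∀ c, conn {e | κ e = c} < L
  row : ∀ c j, κ (hE (K c) j) ≠ c

/-- Recoloring the pocket of color `c` with `c` makes that complement connected and keeps what was
already achieved for the other colors, so three rounds treat them all. -/
theorem IsBad.exists_fill {κ : LatticeQubit L → Fin 3} {K : Fin 3 → Fin (L + 1)}
    (h : IsBad κ K) (c : Fin 3) : ∃ κ', IsBad κ' K ∧ CoConnected {e | κ' e = c} (K c, 0) ∧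
      ∀ b, CoConnected {e | κ e = b} (K b, 0) → CoConnected {e | κ' e = b} (K b, 0) := by
  classical
  set C : Set (LatticeQubit L) := {e | κ e = c} with hC
  set D := pocket C (K c, 0) with hD
  have h1 : {e | (if e ∈ D then c else κ e) = c} = C ∪ D := by
    ext e
    by_cases he : e ∈ D <;> simp [he, hC]
  have h2 : ∀ b, b ≠ c → {e | (if e ∈ D then c else κ e) = b} = {e | κ e = b} \ D := by
    intro b hb
    ext e
    by_cases he : e ∈ D <;> simp [he, hb.symm]
  have hdisj : ∀ b, b ≠ c → Disjoint {e | κ e = b} C := by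
    intro b hb
    rw [Set.disjoint_left]
    intro e he he'
    exact hb (Eq.trans (Eq.symm he) he')
  refine ⟨fun e => if e ∈ D then c else κ e, ⟨?_, ?_⟩, ?_, ?_⟩
  · intro b
    by_cases hb : b = c
    · subst hb
      rw [h1]
      exact conn_union_pocket_le.trans_lt (h.conn_lt b)
    · rw [h2 b hb]
      exact (conn_diff_pocket_le (hdisj b hb)).trans_lt (h.conn_lt b)
  · intro b j hj
    by_cases hDj : hE (K b) j ∈ D
    · rw [if_pos hDj] at hj
      subst hj
      -- Row `K c` avoids color `c` and contains the base point, so none of its edges lies in the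
      -- pocket.
      exact hDj.2 _ (mem_hE.2 (Or.inl rfl)) (edgeReach_row (fun j => h.row c j) _)
    · rw [if_neg hDj] at hj
      exact h.row b j hj
  · rw [h1]
    exact coConnected_union_pocket
  · intro b hb
    by_cases hbc : b = c
    · subst hbc
      rw [h1]
      exact coConnected_union_pocket
    · rw [h2 b hbc]
      exact hb.diff_pocket (hdisj b hbc)

theorem IsBad.exists_coConnected {κ : LatticeQubit L → Fin 3} {K : Fin 3 → Fin (L + 1)}
    (h : IsBad κ K) : ∃ κ', IsBad κ' K ∧ ∀ c, CoConnected {e | κ' e = c} (K c, 0) := by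
  obtain ⟨κ₀, h0, hc0, -⟩ := h.exists_fill 0
  obtain ⟨κ₁, h1, hc1, hp1⟩ := h0.exists_fill 1
  obtain ⟨κ₂, h2, hc2, hp2⟩ := h1.exists_fill 2
  refine ⟨κ₂, h2, fun c => ?_⟩
  fin_cases c
  · exact hp2 _ (hp1 _ hc0)
  · exact hp2 _ hc1
  · exact hc2

/-- A set of small connectivity that misses a row also misses a band. -/
theorem exists_free_band (hL : 0 < L) {A : Set (LatticeQubit L)} (hA : conn A < L)
    {K : Fin (L + 1)} (hK : ∀ j, hE K j ∉ A) : ∃ j, ∀ i, hE i j ∉ A := by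
  by_contra! hcon
  -- If no band were free, all `L` bands would contain edges of both kinds, the missing ones in row
  -- `K`.
  have := card_add_card_le_conn hL A ∅ Finset.univ K (Finset.notMem_empty _)
    (fun j _ => by
      obtain ⟨i, hi⟩ := hcon j
      exact ⟨i, K, hi, hK j⟩) (fun i hi => absurd hi (Finset.notMem_empty _))
  rw [Finset.card_empty, Finset.card_univ, Fintype.card_fin] at this
  omega

theorem exists_adjacent_change {P : Fin L → Prop} {j j' : Fin L} (hj : P j) (hj' : ¬ P j') :
    ∃ k k' : Fin L, k.1 + 1 = k'.1 ∧ ¬ (P k ↔ P k') := by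
  by_contra! hcon
  have key : ∀ n (hn : n < L), (P ⟨0, by omega⟩ ↔ P ⟨n, hn⟩) := by
    intro n
    induction n with
    | zero => exact fun _ => Iff.rfl
    | succ n ih => exact fun hn => (ih (by omega)).trans (hcon ⟨n, by omega⟩ ⟨n + 1, hn⟩ rfl)
  exact hj' ((key j'.1 j'.2).1 ((key j.1 j.2).2 hj))

/-- A set of small connectivity misses a row, or contains one. -/
theorem exists_free_row {A : Set (LatticeQubit L)} (hA : conn A < L) :
    (∃ i, ∀ j, hE i j ∉ A) ∨ ∃ i, ∀ j, hE i j ∈ A := by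
  by_contra! hcon
  have hK : (0 : Fin (L + 1)) ∉ Finset.univ.erase (0 : Fin (L + 1)) := Finset.notMem_erase _ _
  -- Row `0` is spent as the common return path of the row cycles; the other `L` rows each contain a
  -- change.
  have := card_add_card_le_conn (by omega) A (Finset.univ.erase 0) ∅ 0 hK
    (fun j hj => absurd hj (Finset.notMem_empty _)) (fun i _ => by
      obtain ⟨j, hj⟩ := hcon.1 i
      obtain ⟨j', hj'⟩ := hcon.2 i
      obtain ⟨k, k', hk, hkk⟩ := exists_adjacent_change (P := fun j => hE i j ∈ A) hj hj'
      exact ⟨k, k', hk, hkk, Finset.notMem_empty _, Finset.notMem_empty _⟩)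
  rw [Finset.card_empty, Finset.card_erase_of_mem (Finset.mem_univ _), Finset.card_univ,
    Fintype.card_fin] at this
  omega

variable {κ : LatticeQubit L → Fin 3} {K : Fin 3 → Fin (L + 1)}

theorem exists_third (a b : Fin 3) : ∃ c, a ≠ c ∧ b ≠ c := by
  decide +revert

/-- In a band free of two colors every edge has the third color, but that color misses a whole row.
-/
theorem IsBad.free_bands_disjoint (h : IsBad κ K) {a b : Fin 3} (hab : a ≠ b) {j : Fin L}
    (ha : ∀ i, κ (hE i j) ≠ a) (hb : ∀ i, κ (hE i j) ≠ b) : False := by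
  obtain ⟨c, hac, hbc⟩ := exists_third a b
  have h1 := ha (K c)
  have h2 := hb (K c)
  have h3 := h.row c j
  omega

/-- A free band of one color on each side of free bands of the two other colors is impossible. -/
theorem IsBad.false_of_enclosed (h : IsBad κ K)
    (hco : ∀ c, CoConnected {e | κ e = c} (K c, 0)) {a b c : Fin 3} (hab : a ≠ b) (hac : a ≠ c)
    (hbc : b ≠ c) {a₁ a₂ b₀ c₀ : Fin L} (ha₁ : ∀ i, κ (hE i a₁) ≠ a) (ha₂ : ∀ i, κ (hE i a₂) ≠ a)
    (hb₀ : ∀ i, κ (hE i b₀) ≠ b) (hc₀ : ∀ i, κ (hE i c₀) ≠ c) (h1b : a₁ < b₀) (h1c : a₁ < c₀)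
    (hb2 : b₀ < a₂) (hc2 : c₀ < a₂) : False := by
  classical
  have key : ∀ (d : Fin 3) (d₀ : Fin L), (∀ i, κ (hE i d₀) ≠ d) →
      (Finset.univ.filter fun i => ∃ j, j < d₀ ∧ κ (hE i j) = d).card +
      (Finset.univ.filter fun i => ∃ j, d₀ < j ∧ κ (hE i j) = d).card < L := by
    intro d d₀ hd
    refine lt_of_le_of_lt (card_left_add_card_right_le_conn {e | κ e = d} (K d) d₀ (h.row d) hd
      (fun e he v hv => (hco d e he v hv).exists_chain) _ _ ?_ ?_) (h.conn_lt d)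
    · exact fun i hi => (Finset.mem_filter.1 hi).2
    · exact fun i hi => (Finset.mem_filter.1 hi).2
  have hB := key b b₀ hb₀
  have hC := key c c₀ hc₀
  -- Band `a₁` has only colors `b` and `c`, so every row has one of them left of the corresponding
  -- free band; likewise `a₂` on the right. The total is at least `2 (L + 1)`, but `b` and `c` allow
  -- at most `2 (L - 1)`.
  have hl : Fintype.card (Fin (L + 1)) ≤
      (Finset.univ.filter fun i => ∃ j, j < b₀ ∧ κ (hE i j) = b).card +
      (Finset.univ.filter fun i => ∃ j, j < c₀ ∧ κ (hE i j) = c).card := by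
    refine le_trans (Finset.card_le_card fun i _ => ?_) (Finset.card_union_le _ _)
    have : κ (hE i a₁) = b ∨ κ (hE i a₁) = c := by have := ha₁ i; omega
    simp only [Finset.mem_union, Finset.mem_filter, Finset.mem_univ, true_and]
    exact this.imp (fun h => ⟨a₁, h1b, h⟩) (fun h => ⟨a₁, h1c, h⟩)
  have hr : Fintype.card (Fin (L + 1)) ≤
      (Finset.univ.filter fun i => ∃ j, b₀ < j ∧ κ (hE i j) = b).card +
      (Finset.univ.filter fun i => ∃ j, c₀ < j ∧ κ (hE i j) = c).card := by
    refine le_trans (Finset.card_le_card fun i _ => ?_) (Finset.card_union_le _ _)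
    have : κ (hE i a₂) = b ∨ κ (hE i a₂) = c := by have := ha₂ i; omega
    simp only [Finset.mem_union, Finset.mem_filter, Finset.mem_univ, true_and]
    exact this.imp (fun h => ⟨a₂, hb2, h⟩) (fun h => ⟨a₂, hc2, h⟩)
  rw [Fintype.card_fin] at hl hr
  omega

/-- A free band of color `b` cannot separate the free bands of color `a` from those of
color `c`. -/
theorem IsBad.false_of_separated (h : IsBad κ K) {a b c : Fin 3} (hab : a ≠ b) (hac : a ≠ c)
    (hbc : b ≠ c) {q m p : Fin L} (hq : ∀ i, κ (hE i q) ≠ b) (hm : ∀ i, κ (hE i m) ≠ a)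
    (hmq : m < q) (hp : ∀ i, κ (hE i p) ≠ c) (hqp : q < p)
    (ha : ∀ j, (∀ i, κ (hE i j) ≠ a) → j < q) (hc : ∀ j, (∀ i, κ (hE i j) ≠ c) → q < j) :
    False := by
  classical
  have hL : 0 < L := q.pos
  have hrow : ∀ i, (∃ j j' : Fin L, j.1 + 1 = j'.1 ∧
        ¬ (κ (hE i j) = a ↔ κ (hE i j') = a) ∧ j' ≤ q) ∨
      (∃ j j' : Fin L, j.1 + 1 = j'.1 ∧ ¬ (κ (hE i j) = c ↔ κ (hE i j') = c) ∧ q ≤ j) := by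
    intro i
    have hiq : κ (hE i q) = a ↔ κ (hE i q) ≠ c := by
      have := hq i
      omega
    -- `P` splices "has color `a`" up to band `q` with "does not have color `c`" beyond it. The two
    -- agree in band `q`, which is free of `b`, so a change of `P` is a change for `a` on the left
    -- or for `c` on the right. If a row lacks `a` or `c`, the free bands `m`, `q` and `p` supply
    -- both values.
    let P : Fin L → Prop := fun j => if j ≤ q then κ (hE i j) = a else κ (hE i j) ≠ c
    have hP : (∃ j, P j) ∧ ∃ j, ¬ P j := by
      by_cases h1 : ∃ j, κ (hE i j) = a
      · by_cases h2 : ∃ j, κ (hE i j) = c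
        · obtain ⟨j, hj⟩ := h1
          obtain ⟨j', hj'⟩ := h2
          refine ⟨⟨j, ?_⟩, ⟨j', ?_⟩⟩
          · by_cases h : j ≤ q <;> simp [P, h, hj, hac]
          · by_cases h : j' ≤ q <;> simp [P, h, hj', hac.symm]
        · push Not at h2
          refine ⟨⟨q, ?_⟩, ⟨m, ?_⟩⟩
          · simp [P, hiq, h2]
          · simp [P, hmq.le, hm]
      · push Not at h1
        refine ⟨⟨p, ?_⟩, ⟨q, ?_⟩⟩
        · simp [P, hqp, hp]
        · simp [P, h1]
    obtain ⟨⟨j, hj⟩, ⟨j', hj'⟩⟩ := hP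
    obtain ⟨k, k', hk, hkk⟩ := exists_adjacent_change hj hj'
    by_cases hkq : k' ≤ q
    · have hkq' : k ≤ q := by
        rw [Fin.le_def] at hkq ⊢
        omega
      left
      refine ⟨k, k', hk, ?_, hkq⟩
      simpa only [P, hkq, hkq', if_true] using hkk
    · have hkq' : q ≤ k := by
        rw [Fin.le_def] at hkq ⊢
        omega
      right
      refine ⟨k, k', hk, ?_, hkq'⟩
      have hk1 : P k ↔ κ (hE i k) ≠ c := by
        by_cases hkq2 : k ≤ q
        · obtain rfl := le_antisymm hkq2 hkq'
          simp only [P, le_refl, if_true, hiq]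
        · simp only [P, hkq2, if_false]
      have hk2 : P k' ↔ κ (hE i k') ≠ c := by simp only [P, hkq, if_false]
      rw [hk1, hk2] at hkk
      tauto
  let IA : Finset (Fin (L + 1)) := Finset.univ.filter fun i => ∃ j j' : Fin L, j.1 + 1 = j'.1 ∧
    ¬ (κ (hE i j) = a ↔ κ (hE i j') = a) ∧ j' ≤ q
  let IC : Finset (Fin (L + 1)) := Finset.univ.filter fun i => ∃ j j' : Fin L, j.1 + 1 = j'.1 ∧
    ¬ (κ (hE i j) = c ↔ κ (hE i j') = c) ∧ q ≤ j
  have hI : Fintype.card (Fin (L + 1)) ≤ IA.card + IC.card := by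
    refine le_trans (Finset.card_le_card fun i _ => ?_) (Finset.card_union_le _ _)
    simp only [IA, IC, Finset.mem_union, Finset.mem_filter, Finset.mem_univ, true_and]
    exact hrow i
  -- All free bands of `a` lie left of `q`, so each band beyond `q` meets `a`, and it also meets row
  -- `K a`, which avoids `a`. Changes up to `q` are disjoint from these bands.
  have hA : IA.card + (Finset.Ioi q).card ≤ conn {e | κ e = a} := by
    refine card_add_card_le_conn hL _ _ _ (K a) ?_ ?_ ?_
    · intro hK
      obtain ⟨j, j', -, hjj, -⟩ := (Finset.mem_filter.1 hK).2
      exact hjj (iff_of_false (h.row a j) (h.row a j'))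
    · intro j hj
      have : ∃ i, κ (hE i j) = a := by
        by_contra! hcon
        exact lt_asymm (ha j hcon) (Finset.mem_Ioi.1 hj)
      obtain ⟨i, hi⟩ := this
      exact ⟨i, K a, hi, h.row a j⟩
    · intro i hi
      obtain ⟨j, j', hj, hjj, hjq⟩ := (Finset.mem_filter.1 hi).2
      refine ⟨j, j', hj, hjj, ?_, ?_⟩ <;> rw [Finset.mem_Ioi, Fin.lt_def] <;>
        rw [Fin.le_def] at hjq <;> omega
  have hC : IC.card + (Finset.Iio q).card ≤ conn {e | κ e = c} := by
    refine card_add_card_le_conn hL _ _ _ (K c) ?_ ?_ ?_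
    · intro hK
      obtain ⟨j, j', -, hjj, -⟩ := (Finset.mem_filter.1 hK).2
      exact hjj (iff_of_false (h.row c j) (h.row c j'))
    · intro j hj
      have : ∃ i, κ (hE i j) = c := by
        by_contra! hcon
        exact lt_asymm (hc j hcon) (Finset.mem_Iio.1 hj)
      obtain ⟨i, hi⟩ := this
      exact ⟨i, K c, hi, h.row c j⟩
    · intro i hi
      obtain ⟨j, j', hj, hjj, hjq⟩ := (Finset.mem_filter.1 hi).2
      refine ⟨j, j', hj, hjj, ?_, ?_⟩ <;> rw [Finset.mem_Iio, Fin.lt_def] <;>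
        rw [Fin.le_def] at hjq <;> omega
  -- Rows contribute at least `L + 1`, and the bands other than `q` contribute `L - 1`; the sum `2
  -- L` exceeds the `2 (L - 1)` available to `a` and `c`.
  have h1 := h.conn_lt a
  have h2 := h.conn_lt c
  rw [Fin.card_Ioi] at hA
  rw [Fin.card_Iio] at hC
  rw [Fintype.card_fin] at hI
  have := q.2
  omega

theorem not_isBad : ¬ IsBad κ K := by
  classical
  intro h
  obtain ⟨κ, h, hco⟩ := h.exists_coConnected
  have hL : 0 < L := (Nat.zero_le _).trans_lt (h.conn_lt 0)
  have hmin : ∀ c, ∃ m : Fin L, (∀ i, κ (hE i m) ≠ c) ∧ ∀ j, (∀ i, κ (hE i j) ≠ c) → m ≤ j := by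
    intro c
    obtain ⟨j, hj⟩ := exists_free_band hL (h.conn_lt c) (h.row c)
    obtain ⟨m, hm, hm'⟩ := Finset.exists_min_image
      (Finset.univ.filter fun j : Fin L => ∀ i, κ (hE i j) ≠ c) id
      ⟨j, Finset.mem_filter.2 ⟨Finset.mem_univ _, hj⟩⟩
    exact ⟨m, (Finset.mem_filter.1 hm).2,
      fun j hj => hm' j (Finset.mem_filter.2 ⟨Finset.mem_univ _, hj⟩)⟩
  choose m hm hm' using hmin
  -- `c` is the color whose first free band comes last, and `q` will be the last band before `m c`
  -- that is free of another color, called `b`.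
  obtain ⟨c, hcmax⟩ := Finite.exists_max m
  have hlt : ∀ d, d ≠ c → m d < m c := fun d hd =>
    lt_of_le_of_ne (hcmax d) fun he => h.free_bands_disjoint hd (hm d) (he ▸ hm c)
  obtain ⟨d, hd⟩ : ∃ d : Fin 3, d ≠ c := exists_ne c
  obtain ⟨q, hq, hqmax⟩ := Finset.exists_max_image
    (Finset.univ.filter fun j : Fin L => j < m c ∧ ∃ d, d ≠ c ∧ ∀ i, κ (hE i j) ≠ d) id
    ⟨m d, Finset.mem_filter.2 ⟨Finset.mem_univ _, hlt d hd, d, hd, hm d⟩⟩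
  obtain ⟨-, hqp, b, hbc, hqb⟩ := Finset.mem_filter.1 hq
  obtain ⟨a, hba, hca⟩ := exists_third b c
  have hab := hba.symm
  have hac := hca.symm
  have hless : ∀ j, (∀ i, κ (hE i j) ≠ a) → j < m c → j < q := fun j hj hjc =>
    lt_of_le_of_ne (hqmax j (Finset.mem_filter.2 ⟨Finset.mem_univ _, hjc, a, hac, hj⟩))
      (by rintro rfl; exact h.free_bands_disjoint hab hj hqb)
  have hmq := hless _ (hm a) (hlt a hac)
  refine h.false_of_separated hab hac hbc hqb (hm a) hmq (hm c) hqp (fun j hj => ?_)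
    (fun j hj => hqp.trans_le (hm' c j hj))
  -- A free band of `a` beyond `m c` would enclose, together with `m a`, the bands `q` and `m c`.
  rcases lt_trichotomy j (m c) with hjc | hjc | hjc
  · exact hless j hj hjc
  · exact (h.free_bands_disjoint hac hj (hjc ▸ hm c)).elim
  · exact (h.false_of_enclosed hco hab hac hbc (hm a) hj hqb (hm c) hmq (hlt a hac)
      (hqp.trans hjc) hjc).elim

end Coloring

/-! ### The entanglement width of the planar code state -/

section Width

variable {L : ℕ}

theorem exists_le_conn_side (hL : 1 ≤ L) (T : SubcubicTree (LatticeQubit L)) :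
    ∃ d : T.graph.Dart, L ≤ conn (T.side d) := by
  by_contra! hcon
  obtain ⟨v, hv⟩ := T.exists_vertex_of_orientation (fun S => ∃ i, ∀ j, hE i j ∉ S) (fun d => by
    rcases exists_free_row (hcon d) with h | ⟨i, hi⟩
    · exact Or.inl h
    · exact Or.inr ⟨i, fun j h => h (hi j)⟩)
  rcases T.degree_eq v with hdeg | hdeg
  · obtain ⟨d, hd, q₀, hq₀⟩ := T.exists_side_of_leaf hdeg
    obtain ⟨i, hi⟩ := hv d hd
    -- At a leaf the side omits a single qubit, but a free band would consist of `L + 1 ≥ 2` omitted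
    -- edges.
    obtain ⟨j, hj⟩ := exists_free_band hL (hcon d) hi
    have hq : ∀ i, hE i j = q₀ := fun i => by
      have := hj i
      rwa [hq₀, Set.mem_compl_iff, not_not] at this
    have h := (hE_inj.1 ((hq 0).trans (hq (Fin.last L)).symm)).1
    rw [Fin.ext_iff, Fin.val_zero, Fin.val_last] at h
    omega
  · obtain ⟨d, hd, hq⟩ := T.exists_three_sides hdeg
    choose κ hκ hκ' using hq
    choose K hK using fun c => hv (d c) (hd c)
    have hset : ∀ c, {e | κ e = c} = T.side (d c) := by
      intro c
      ext e
      exact ⟨fun h => h ▸ hκ e, fun h => (hκ' e c h).symm⟩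
    refine not_isBad (κ := κ) (K := K) ⟨fun c => ?_, fun c j h => ?_⟩
    · rw [hset]
      exact hcon _
    · have := hκ (hE (K c) j)
      simp only [h] at this
      exact hK c j this

theorem three_le_card_latticeQubit (hL : 1 ≤ L) : 3 ≤ Fintype.card (LatticeQubit L) := by
  let f : Fin (L + 1) ⊕ Fin L → LatticeQubit L :=
    Sum.elim (fun i => hE i ⟨0, hL⟩) (fun i => vE i 0)
  have hf : Function.Injective f := by
    rintro (i | i) (j | j) h
    · exact congrArg Sum.inl (hE_inj.1 h).1
    · exact absurd h hE_ne_vE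
    · exact absurd h.symm hE_ne_vE
    · exact congrArg Sum.inr (vE_inj.1 h).1
  have := Fintype.card_le_of_injective f hf
  rw [Fintype.card_sum, Fintype.card_fin, Fintype.card_fin] at this
  omega

theorem planarCodeState_ne_zero {V : Type*} [Fintype V] {G : SimpleGraph V} :
    planarCodeState G ≠ 0 := by
  classical
  intro h
  have h0 := congrFun h 0
  rw [planarCodeState_eq, codeState, if_pos (Submodule.zero_mem _)] at h0
  simp at h0

end Width

theorem mainTheorem2 (L : ℕ) (hL : 1 ≤ L) :
    (L : ℝ) ≤ entanglementWidth (planarCodeState (squareLattice L)) ∧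
    (∀ T : SubcubicTree (LatticeQubit L), ∃ d : T.graph.Dart, IsBalanced (T.side d)) ∧
    (∀ (T : SubcubicTree (LatticeQubit L)) (N : TreeTensorNetwork T),
      N.state = planarCodeState (squareLattice L) →
        (∃ e : T.graph.edgeSet, 2 ^ L ≤ N.bond e) ∧ 2 ^ L ≤ N.numEntries) := by
  classical
  refine ⟨?_, fun T => T.exists_isBalanced (three_le_card_latticeQubit hL), ?_⟩
  -- A real infimum over an empty family would be `0`, so the lower bound depends on a subcubic tree
  -- existing.
  · have := nonempty_subcubicTree (three_le_card_latticeQubit hL)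
    refine le_ciInf fun T => ?_
    obtain ⟨d, hd⟩ := exists_le_conn_side hL T
    refine le_ciSup_of_le (Set.finite_range _).bddAbove d ?_
    exact (Nat.cast_le.2 hd).trans (conn_le_entanglementEntropy _)
  · intro T N h
    obtain ⟨d, hd⟩ := exists_le_conn_side hL T
    obtain ⟨F, H, hFH⟩ := N.exists_factorization d
    rw [h] at hFH
    have hbond := (Nat.pow_le_pow_right two_pos hd).trans
      (two_pow_conn_le_of_factorization _ F H hFH)
    exact ⟨⟨_, hbond⟩, hbond.trans (N.bond_le_numEntries (h ▸ planarCodeState_ne_zero) _)⟩
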